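/- Let $V'=\mathbf C^m$ carry a non-degenerate symmetric bilinear form $\langle\,,\,\rangle$, and regard $V'$ as the affine part of $\mathbf P^m=\mathbf P(\mathbf C\oplus V')$, the complement of the hyperplane at infinity $\mathbf P_\infty=\mathbf P(V')$. *Focal loci.* For a projective variety $X\subset\mathbf P^m$ not contained in $\mathbf P_\infty$ and a smooth point $x\in X\setminus\mathbf P_\infty$ with projective tangent space $\mathbf P(\hat T_x)$, the normal space $N_x(X)$ is the join of $x$ with $\mathbf P\big((\hat T_x\cap V')^{\perp}\big)\subset\mathbf P_\infty$. The normal variety $N_X\subset\mathbf P^m\times\mathbf P^m$ is the closure of $N_X^{good}=\{(x,y): x\in X\setminus\mathbf P_\infty\text{ smooth on }X,\ y\in N_x(X)\}$, and $\pi:N_X\to\mathbf P^m$ is the second projection. $X$ is *isotropically focally degenerate* if $\pi$ is not dominant. The focal locus $\Sigma_X$ is the closure of $\pi(Y_X^{good})$, where $Y_X^{good}$ is the ramification locus of $\pi:N_X^{good}\to\mathbf P^m$. *Inverse focal construction.* Let $\Sigma\subset\mathbf P^m$ be an irreducible projective variety with affine part $\Sigma\cap V'\neq\emptyset$, and $r$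 a (possibly multivalued) algebraic function on $\Sigma\cap V'$, given by its graph $\Sigma^\star\subset(\Sigma\cap V')\times\mathbf C$, an irreducible closed subvariety dominating $\Sigma\cap V'$ and of the same dimension. Consider the points $s=(O,r(s))\in\Sigma^\star$, smooth on $\Sigma^\star$, with $O=O(s)$ smooth on $\Sigma$ and with $T_{\Sigma^\star,s}\to T_{\Sigma,O}$ bijective, so that $T_{\Sigma^\star,s}$ is the graph of the differential $dr(s):T_{\Sigma,O}\to\mathbf C$. Let $X'\subset V'$ be the set of all $x$ such that, for some such $s$, $$\langle x-O(s),x-O(s)\rangle=r(s),\qquad dr(s)(\eta)=-2\langle x-O(s),\eta\rangle\quad\text{for all }\eta\in T_{\Sigma,O(s)},$$ and let $X$ be the closure of $X'$ in $\mathbf P^m$. **Theorem 5.** Let $\Sigma$ and $r$ be as above, with $\dim\Sigma\le m-1$. Assume: 1) at every smooth point $O$ of $\Sigma\cap V'$ the tangent space $T_{\Sigma,O}\subset V'$ has a totally isotropic annihilator $T_{\Sigma,O}^{\perp}$; 2.1) for all $s$ as above, $dr(s)$ lies in the image of the map $T_{\Sigma,O(s)}\to T_{\Sigma,O(s)}^\vee$,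 $\xi\mapsto\langle\xi,\cdot\rangle$; 2.2) for all $s$ as above and every $\xi\in T_{\Sigma,O(s)}$ with image $dr(s)$, $\tfrac14\langle\xi,\xi\rangle=r(s)$. Then $X$ is an irreducible projective variety not contained in $\mathbf P_\infty$, it is isotropically focally degenerate, and $\Sigma=\Sigma_X$. -/

import Mathlib

namespace FocalLoci

open MvPolynomial

noncomputable section

/-! ## Affine sets: Zariski closure, dimension, tangent spaces, smooth points -/

variable {ι : Type}

/-- The Zariski closure of a subset of affine space. -/
def zariskiClosure (S : Set (ι → ℂ)) : Set (ι → ℂ) :=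
  zeroLocus ℂ (vanishingIdeal ℂ S)

/-- An (irreducible, closed) affine variety: a Zariski closed set with prime vanishing ideal. -/
def IsAffineVariety (S : Set (ι → ℂ)) : Prop :=
  zariskiClosure S = S ∧ (vanishingIdeal ℂ S).IsPrime

/-- The ring of polynomial functions on `S`. -/
abbrev CoordRing (S : Set (ι → ℂ)) : Type :=
  MvPolynomial ι ℂ ⧸ vanishingIdeal ℂ S

/-- The dimension of (the Zariski closure of) `S`: the maximal number of algebraically independent
polynomial functions on `S`, i.e. for an irreducible `S` the transcendence degree of its function
field. -/
def dimension (S : Set (ι → ℂ)) : Cardinal :=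
  Algebra.trdeg ℂ (CoordRing S)

/-- The Zariski tangent space of `S` at `p`: the vectors killed by the differentials at `p` of all
polynomials vanishing on `S`. -/
def tangentSpace [Fintype ι] (S : Set (ι → ℂ)) (p : ι → ℂ) : Submodule ℂ (ι → ℂ) where
  carrier := {t | ∀ f ∈ vanishingIdeal ℂ S, ∑ i, eval p (pderiv i f) * t i = 0}
  zero_mem' := by intro f _; simp
  add_mem' := by
    intro s t hs ht f hf
    have h1 := hs f hf
    have h2 := ht f hf
    simp only [Pi.add_apply, mul_add, Finset.sum_add_distrib, h1, h2, add_zero]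
  smul_mem' := by
    intro c t ht f hf
    have h : c * ∑ i, eval p (pderiv i f) * t i = 0 := by rw [ht f hf, mul_zero]
    rw [Finset.mul_sum] at h
    rw [← h]
    refine Finset.sum_congr rfl fun i _ => ?_
    simp only [Pi.smul_apply, smul_eq_mul]
    ring

/-- `p` is a smooth point of `S` (`S` irreducible): the tangent space at `p` has the dimension of
`S`. -/
def IsSmoothPoint [Fintype ι] (S : Set (ι → ℂ)) (p : ι → ℂ) : Prop :=
  p ∈ S ∧ Module.rank ℂ (tangentSpace S p) = dimension S

/-! ## Projective space

`P m` is the projective space of `V = ℂ ⊕ V'`, where `V' = ℂ^m`; the coordinate with index `0` is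
the one of the summand `ℂ`, so that the hyperplane at infinity is `x 0 = 0`. -/

/-- The space `V = ℂ ⊕ V'`. -/
abbrev V (m : ℕ) : Type := Fin (m + 1) → ℂ

/-- Projective space of dimension `m`. -/
abbrev P (m : ℕ) : Type := Projectivization ℂ (V m)

variable {m : ℕ}

/-- The hyperplane at infinity. -/
def atInfinity (m : ℕ) : Set (P m) := {x | x.rep 0 = 0}

/-- The inclusion of `V'` in `V`. -/
def inclV' (m : ℕ) : (Fin m → ℂ) →ₗ[ℂ] V m where
  toFun u := Fin.cons 0 u
  map_add' u v := by
    funext i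
    refine Fin.cases ?_ (fun j => ?_) i <;> simp
  map_smul' c v := by
    funext i
    refine Fin.cases ?_ (fun j => ?_) i <;> simp

/-- The point `(1 : u)` of projective space attached to a point `u` of the affine space `V'`. -/
def ofAffine (u : Fin m → ℂ) : P m :=
  Projectivization.mk ℂ (Fin.cons 1 u : V m) (fun h => by simpa using congrFun h 0)

/-- The affine part of a subset of projective space. -/
def affinePart (X : Set (P m)) : Set (Fin m → ℂ) := {u | ofAffine u ∈ X}

/-- The affine cone over `X`, without the origin. A polynomial vanishes on it if and only if all of
its homogeneous components vanish on `X`. -/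
def cone (X : Set (P m)) : Set (V m) :=
  {v | ∃ h : v ≠ 0, Projectivization.mk ℂ v h ∈ X}

/-- The Zariski closure in projective space. -/
def projClosure (X : Set (P m)) : Set (P m) :=
  {x | ∀ f ∈ vanishingIdeal ℂ (cone X), ∀ v ∈ cone {x}, eval v f = 0}

/-- An (irreducible, closed) projective variety. -/
def IsProjectiveVariety (X : Set (P m)) : Prop :=
  projClosure X = X ∧ (vanishingIdeal ℂ (cone X)).IsPrime

/-- The cone in `V × V` over a subset of the product of two projective spaces. A polynomial vanishes
on it if and only if all of its bihomogeneous components vanish on `N`. -/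
def bicone (N : Set (P m × P m)) : Set (Fin (m + 1) ⊕ Fin (m + 1) → ℂ) :=
  {u | ∃ (h₁ : (fun i => u (Sum.inl i) : V m) ≠ 0) (h₂ : (fun i => u (Sum.inr i) : V m) ≠ 0),
    (Projectivization.mk ℂ _ h₁, Projectivization.mk ℂ _ h₂) ∈ N}

/-- The Zariski closure in the product of two projective spaces. -/
def biprojClosure (N : Set (P m × P m)) : Set (P m × P m) :=
  {z | ∀ f ∈ vanishingIdeal ℂ (bicone N), ∀ u ∈ bicone {z}, eval u f = 0}

/-! ## Normal spaces, the normal variety, focal loci -/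

section Focal

variable (B : LinearMap.BilinForm ℂ (Fin m → ℂ))

/-- The projective tangent space of `X` at `x`, as a vector subspace of `V`. -/
def projTangentSpace (X : Set (P m)) (x : P m) : Submodule ℂ (V m) :=
  tangentSpace (cone X) x.rep

/-- `x` is a smooth point of the projective variety `X`. -/
def IsProjSmoothPoint (X : Set (P m)) (x : P m) : Prop :=
  IsSmoothPoint (cone X) x.rep

/-- The orthogonal `L^{⊥_x}` at the point `x` of the projective linear subspace with underlying
vector space `L ⊆ V`: the join of `x` with the polar of the direction `L ∩ V'`. -/
def orthogonalAt (L : Submodule ℂ (V m)) (x : P m) : Submodule ℂ (V m) :=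
  x.submodule ⊔ (B.orthogonal (L.comap (inclV' m))).map (inclV' m)

/-- The normal space of `X` at `x`. -/
def normalSpace (X : Set (P m)) (x : P m) : Submodule ℂ (V m) :=
  orthogonalAt B (projTangentSpace X x) x

/-- The pairs `(x, y)` with `x` a smooth point of `X`, not at infinity, and `y` a point of the
normal space of `X` at `x`. -/
def normalGood (X : Set (P m)) : Set (P m × P m) :=
  {z | z.1 ∈ X ∧ IsProjSmoothPoint X z.1 ∧ z.1 ∉ atInfinity m ∧
    z.2.submodule ≤ normalSpace B X z.1}

/-- The normal variety `N_X`. -/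
def normalVariety (X : Set (P m)) : Set (P m × P m) :=
  biprojClosure (normalGood B X)

/-- The differential at `z = (x, y)` of the second projection `N → ℙ(V)` is onto the tangent space
of `ℙ(V)` at `y`. The latter is identified with `V / ⟨y⟩`, and the former is computed on the tangent
space of the bicone over `N`, which maps onto the tangent space of `N`. -/
def SndSubmersiveAt (N : Set (P m × P m)) (z : P m × P m) : Prop :=
  (tangentSpace (bicone N) (Sum.elim z.1.rep z.2.rep)).map
      (LinearMap.funLeft ℂ ℂ (Sum.inr : Fin (m + 1) → Fin (m + 1) ⊕ Fin (m + 1))) ⊔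
    z.2.submodule = ⊤

/-- The ramification locus of the second projection `π` on the good part of the normal variety: the
points where the differential of `π` is not an isomorphism. Source and target are smooth of the same
dimension `m`, so this means that the differential is not onto. -/
def ramificationGood (X : Set (P m)) : Set (P m × P m) :=
  {z | z ∈ normalGood B X ∧ ¬ SndSubmersiveAt (normalGood B X) z}

/-- The focal locus `Σ_X`: the closure of the image under `π` of the ramification locus. -/
def focalLocus (X : Set (P m)) : Set (P m) :=
  projClosure (Prod.snd '' ramificationGood B X)

/-- `X` is isotropically focally degenerate: the second projection `π : N_X → ℙ(V)` is not
dominant. -/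
def IsIsotropicallyFocallyDegenerate (X : Set (P m)) : Prop :=
  projClosure (Prod.snd '' normalVariety B X) ≠ Set.univ

/-! ## Algebraic functions and the inverse focal construction

A point of `V' × ℂ` is written as `p : Fin (m + 1) → ℂ` with `O = Fin.tail p` in `V'` and
`r = p 0`. -/

/-- `R ⊆ V' × ℂ` is the graph of a (possibly multivalued) algebraic function on the affine part of
`S`: an irreducible closed subvariety of `S × ℂ` which dominates `S` and has the same dimension
as `S`. -/
def IsAlgebraicFunction (S : Set (P m)) (R : Set (Fin (m + 1) → ℂ)) : Prop :=
  IsAffineVariety R ∧ (∀ p ∈ R, (Fin.tail p : Fin m → ℂ) ∈ affinePart S) ∧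
    affinePart S ⊆ zariskiClosure ((fun p => (Fin.tail p : Fin m → ℂ)) '' R) ∧
    dimension R = dimension (affinePart S)

/-- The points `p = (O, r)` of the graph at which `O` is a smooth point of `S` and the algebraic
function has a differential `dr` on the tangent space of `S` at `O`: the point is smooth on the
graph and the graph has no vertical tangent vector there. At such a point the tangent space of the
graph consists of the vectors `(η, dr(η))`, for `η` tangent to `S` at `O`. -/
def graphGood (S : Set (P m)) (R : Set (Fin (m + 1) → ℂ)) : Set (Fin (m + 1) → ℂ) :=
  {p | IsSmoothPoint R p ∧ IsSmoothPoint (affinePart S) (Fin.tail p) ∧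
    ∀ t ∈ tangentSpace R p, (Fin.tail t : Fin m → ℂ) = 0 → t = 0}

/-- The vector `ξ`, tangent to `S` at `O`, is sent to `dr` by `T_S → T_S^∨`, the map induced by the
quadratic form; here `p = (O, r)`. -/
def MapsToDifferential (S : Set (P m)) (R : Set (Fin (m + 1) → ℂ)) (p : Fin (m + 1) → ℂ)
    (ξ : Fin m → ℂ) : Prop :=
  ξ ∈ tangentSpace (affinePart S) (Fin.tail p) ∧
    ∀ t ∈ tangentSpace R p, B ξ (Fin.tail t) = t 0

/-- The family of spheres: pairs `(x, (O, r))` with `⟨x - O, x - O⟩ = r`. -/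
def spheres : Set ((Fin m → ℂ) × (Fin (m + 1) → ℂ)) :=
  {z | B (z.1 - Fin.tail z.2) (z.1 - Fin.tail z.2) = z.2 0}

/-- The family of affine spaces: pairs `(x, (O, r))` such that `(x - O, 1/2)` is orthogonal to the
tangent space of the graph at `(O, r)`, for the orthogonal sum of the given form and of the form `1`
on `ℂ`. -/
def affineSpaces (R : Set (Fin (m + 1) → ℂ)) : Set ((Fin m → ℂ) × (Fin (m + 1) → ℂ)) :=
  {z | ∀ t ∈ tangentSpace R z.2, B (z.1 - Fin.tail z.2) (Fin.tail t) + (1 / 2) * t 0 = 0}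

/-- The variety `Z'`, intersection of the family of spheres and of the family of affine spaces. -/
def inverseIncidence (S : Set (P m)) (R : Set (Fin (m + 1) → ℂ)) :
    Set ((Fin m → ℂ) × (Fin (m + 1) → ℂ)) :=
  {z | z.2 ∈ graphGood S R ∧ z ∈ spheres B ∧ z ∈ affineSpaces B R}

/-- The result of the inverse focal construction: the closure in projective space of the projection
of `Z'` to the affine space `V'`. -/
def inverseFocal (S : Set (P m)) (R : Set (Fin (m + 1) → ℂ)) : Set (P m) :=
  projClosure (ofAffine '' (Prod.fst '' inverseIncidence B S R))

/-- The vector subspace `W` has a totally isotropic annihilator. -/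
def HasTotallyIsotropicAnnihilator (W : Submodule ℂ (Fin m → ℂ)) : Prop :=
  ∀ u ∈ B.orthogonal W, ∀ v ∈ B.orthogonal W, B u v = 0

end Focal

end

end FocalLoci

open FocalLoci

namespace FocalLoci
open MvPolynomial

/-! ### Extension of derivations in characteristic zero -/

section Derivations

open TensorProduct

/-! Let M be the Gram matrix of the form. A point x lies over a good graph point (O, r) when the
covector (1/2, M(x - O)), with the graph coordinate first, annihilates the tangent space of the
graph and x lies on the sphere. The second condition follows from the first: -2(x - O) represents
dr, so it differs from a tangent ξ representing dr by an element of T^⊥. Isotropy gives T^⊥ ⊆ T, so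
-2(x - O) is itself tangent and 2.2) yields the sphere equation (`mem_spheres_of_mem_affineSpaces`).
Hence the cone over X is parametrized by conormal vectors of the graph. If n is the dimension of the
graph and W = (W_0, W') the generic combination of d = m + 1 - n independent gradients, the generic
point is x = (2W_0 : 2W_0 O + M⁻¹W'). The ideal of the cone is the kernel of a map into a domain
(`vanishingIdeal_cone_inverseFocal`), so X is irreducible.

Let K be the function field of the parameter space, of transcendence degree n + d = m + 1, and L the
subfield generated by the coordinates of x. In characteristic zero a tangent vector of the cone at x
extends to a derivation of K. Differentiating the sphere equation, the variation of (O, r) cancels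
because W is conormal, and what remains says that W' kills the tangent directions with zero first
coordinate (`dotProduct_tail_eq_zero`). So O lies in the normal space at x. Expand W' in an L-basis
of conormal tails: together with L the coefficients recover W', then (O, r), hence K, and a count of
transcendence degrees makes them algebraically independent over L
(`exists_algebraicIndependent_conormal`). Thus O is a generic point of the normal space, and every
equation of Σ holds on the whole normal space (`aeval_normal_eq_zero`, `exists_generic_normal`).

Consequently π(N_X) ⊆ Σ, a proper subvariety, so X is degenerate, and π is not submersive over
points of Σ where some equation has nonzero gradient (`not_sndSubmersiveAt`). Conversely, for
general parameters (x, O) is a ramified good pair and O avoids any prescribed proper closed subset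
of Σ, so the ramified image is dense in Σ. -/

theorem formallySmooth_field_of_charZero (F K : Type*) [Field F] [Field K] [Algebra F K]
    [CharZero F] : Algebra.FormallySmooth F K := by
  obtain ⟨s, hs⟩ := exists_isTranscendenceBasis F K
  have : Algebra.IsAlgebraic (IntermediateField.adjoin F (Set.range ((↑) : s → K))) K :=
    hs.isAlgebraic_field
  exact Algebra.FormallySmooth.of_algebraicIndependent_of_isSeparable hs.1

theorem formallySmooth_domain_of_charZero (A K : Type*) [CommRing A] [IsDomain A] [Field K]
    [Algebra A K] [FaithfulSMul A K] [CharZero A] : Algebra.FormallySmooth A K := by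
  let := FractionRing.liftAlgebra A K
  have h1 : Algebra.FormallySmooth A (FractionRing A) := .of_isLocalization (nonZeroDivisors A)
  have : CharZero (FractionRing A) :=
    charZero_of_injective_algebraMap (IsFractionRing.injective A (FractionRing A))
  have h2 := formallySmooth_field_of_charZero (FractionRing A) K
  exact .comp _ (FractionRing A) _

/-- Formal smoothness of K over A kills the first cotangent homology, so K ⊗ Ω_A → Ω_K is injective.
A K-linear left inverse of this map transports d to a derivation of K. -/
theorem Derivation.exists_extension (k A K : Type*) [CommRing k] [CommRing A] [IsDomain A]
    [Field K] [Algebra k A] [Algebra A K] [Algebra k K] [IsScalarTower k A K] [FaithfulSMul A K]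
    [CharZero A] (d : Derivation k A K) :
    ∃ D : Derivation k K K, ∀ a, D (algebraMap A K a) = d a := by
  have := formallySmooth_domain_of_charZero A K
  have hinj : Function.Injective (KaehlerDifferential.mapBaseChange k A K) := by
    rw [injective_iff_map_eq_zero]
    intro x hx
    obtain ⟨x, rfl⟩ := (Algebra.H1Cotangent.exact_δ_mapBaseChange k A K x).mp hx
    rw [Subsingleton.elim x 0, map_zero]
  obtain ⟨g, hg⟩ := LinearMap.exists_leftInverse_of_injective _ (LinearMap.ker_eq_bot.mpr hinj)
  refine ⟨((d.liftKaehlerDifferential.liftBaseChange K) ∘ₗ g).compDer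
    (KaehlerDifferential.D k K), fun a => ?_⟩
  have h : KaehlerDifferential.D k K (algebraMap A K a) =
      KaehlerDifferential.mapBaseChange k A K (1 ⊗ₜ KaehlerDifferential.D k A a) := by
    simp
  have h2 := LinearMap.congr_fun hg (1 ⊗ₜ KaehlerDifferential.D k A a)
  simp only [LinearMap.comp_apply, LinearMap.id_apply] at h2
  simp [h, h2, -KaehlerDifferential.mapBaseChange_tmul]

/-- A derivation which vanishes on a subring vanishes on the elements algebraic over it. -/
theorem Derivation.eq_zero_of_isAlgebraic {k A K : Type*} [CommRing k] [CommRing A]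
    [Field K] [Algebra A K] [Algebra k K] [FaithfulSMul A K]
    [CharZero K] (D : Derivation k K K) (hD : ∀ a, D (algebraMap A K a) = 0) {y : K}
    (hy : IsAlgebraic A y) : D y = 0 := by
  let D' : Derivation A K K := Derivation.mk'
    { toFun := D
      map_add' := map_add D
      map_smul' := fun a x => by simp [Algebra.smul_def, hD] }
    (fun a b => by simp)
  -- Since D' is A-linear, applying it to p(y) = 0 gives p'(y) D'(y) = 0. Either D'(y) = 0, or p' is
  -- a nonzero relation of smaller degree.
  have key : ∀ n : ℕ, ∀ p : Polynomial A, p ≠ 0 → p.natDegree ≤ n → Polynomial.aeval y p = 0 →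
      D' y = 0 := by
    have : IsDomain A := (FaithfulSMul.algebraMap_injective A K).isDomain (algebraMap A K)
    have : CharZero A := by
      refine ⟨fun a b h => ?_⟩
      have := congrArg (algebraMap A K) h
      simpa using this
    intro n
    induction n with
    | zero =>
      intro p hp hn h0
      rw [Polynomial.eq_C_of_natDegree_le_zero hn, Polynomial.aeval_C] at h0
      rw [FaithfulSMul.algebraMap_eq_zero_iff] at h0
      rw [Polynomial.eq_C_of_natDegree_le_zero hn, h0] at hp
      simp at hp
    | succ n ih =>
      intro p hp hn h0
      by_cases hd : p.natDegree ≤ n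
      · exact ih p hp hd h0
      have h1 := D'.map_aeval p y
      rw [h0, map_zero, smul_eq_mul] at h1
      rcases mul_eq_zero.mp h1.symm with h2 | h2
      · refine ih _ ?_ ?_ h2
        · intro h3
          have := Polynomial.derivative_eq_zero.mp h3
          omega
        · have := Polynomial.natDegree_derivative_le p
          omega
      · exact h2
  obtain ⟨p, hp, h0⟩ := hy
  exact key _ p hp le_rfl h0

end Derivations


/-! ### Gradients, conormal spaces, and the generic tangent space -/

section Gradient

variable {ι k K : Type} [Field k] [Field K] [Algebra k K]

/-- The gradient of a polynomial at a point with coordinates in a `k`-algebra. -/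
noncomputable def grad {E : Type} [CommRing E] [Algebra k E] (x : ι → E) (f : MvPolynomial ι k) :
    ι → E :=
  fun i => aeval x (pderiv i f)

section

variable {E : Type} [CommRing E] [Algebra k E] (x : ι → E)

theorem grad_add (f g : MvPolynomial ι k) : grad x (f + g) = grad x f + grad x g := by
  ext i; simp [grad]

theorem grad_sub (f g : MvPolynomial ι k) : grad x (f - g) = grad x f - grad x g := by
  ext i; simp [grad]

theorem grad_C_mul (c : k) (f : MvPolynomial ι k) : grad x (C c * f) = c • grad x f := by
  ext i; simp [grad, Algebra.smul_def]

theorem grad_mul (f g : MvPolynomial ι k) :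
    grad x (f * g) = aeval x f • grad x g + aeval x g • grad x f := by
  ext i; simp [grad]

theorem grad_X [DecidableEq ι] (i : ι) : grad x (X i : MvPolynomial ι k) = Pi.single i 1 := by
  ext j
  simp only [grad, pderiv_X, Pi.single_apply]
  split_ifs <;> simp_all

theorem grad_C (c : k) : grad x (C c : MvPolynomial ι k) = 0 := by
  ext j; simp [grad]

theorem grad_map {E' : Type} [CommRing E'] [Algebra k E'] (φ : E →ₐ[k] E')
    (f : MvPolynomial ι k) : grad (fun i => φ (x i)) f = fun i => φ (grad x f i) := by
  ext i
  simp only [grad]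
  rw [← AlgHom.comp_apply, comp_aeval]

theorem Derivation.map_aeval_eq [Fintype ι] (D : Derivation k E E) (f : MvPolynomial ι k) :
    D (aeval x f) = grad x f ⬝ᵥ fun i => D (x i) := by
  classical
  induction f using MvPolynomial.induction_on with
  | C a => simp [grad_C]
  | add p q hp hq => simp [grad_add, hp, hq, add_dotProduct]
  | mul_X p i hp =>
    rw [map_mul, Derivation.leibniz, hp, grad_mul, add_dotProduct, grad_X, smul_dotProduct,
      smul_dotProduct]
    simp

end

variable [Fintype ι]

variable (K ι) in
/-- The standard bilinear form on coordinate space. -/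
noncomputable def dotForm : LinearMap.BilinForm K (ι → K) := dotProductBilin K K

@[simp] theorem dotForm_apply (v w : ι → K) : dotForm ι K v w = v ⬝ᵥ w := rfl

theorem dotForm_nondegenerate : (dotForm ι K).Nondegenerate := by
  classical
  refine ⟨fun v h => ?_, fun v h => ?_⟩
  · ext i; simpa using h (Pi.single i 1)
  · ext i; simpa using h (Pi.single i 1)

theorem dotForm_isRefl : (dotForm ι K).IsRefl := fun v w h => by
  simpa [dotProduct_comm] using h

/-- The vectors annihilated by a space of covectors. -/
noncomputable def annihilated (N : Submodule K (ι → K)) : Submodule K (ι → K) :=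
  (dotForm ι K).orthogonal N

theorem mem_annihilated {N : Submodule K (ι → K)} {t : ι → K} :
    t ∈ annihilated N ↔ ∀ q ∈ N, q ⬝ᵥ t = 0 := Iff.rfl

theorem mem_annihilated_span {s : Set (ι → K)} {t : ι → K} :
    t ∈ annihilated (Submodule.span K s) ↔ ∀ q ∈ s, q ⬝ᵥ t = 0 := by
  refine ⟨fun h q hq => h q (Submodule.subset_span hq), fun h q hq => ?_⟩
  change dotForm ι K q t = 0
  induction hq using Submodule.span_induction with
  | mem q hq => exact h q hq
  | zero => simp
  | add a b _ _ ha hb => rw [map_add, LinearMap.add_apply, ha, hb, add_zero]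
  | smul c a _ ha => rw [map_smul, LinearMap.smul_apply, ha, smul_zero]

theorem annihilated_annihilated (N : Submodule K (ι → K)) : annihilated (annihilated N) = N :=
  LinearMap.BilinForm.orthogonal_orthogonal dotForm_nondegenerate dotForm_isRefl N

theorem mem_of_dotProduct_annihilated {N : Submodule K (ι → K)} {q : ι → K}
    (h : ∀ t ∈ annihilated N, q ⬝ᵥ t = 0) : q ∈ N := by
  rw [← annihilated_annihilated N]
  intro t ht
  change t ⬝ᵥ q = 0
  rw [dotProduct_comm]
  exact h t ht

theorem finrank_annihilated (N : Submodule K (ι → K)) :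
    Module.finrank K (annihilated N) + Module.finrank K N = Fintype.card ι := by
  have h := LinearMap.BilinForm.finrank_orthogonal (dotForm_nondegenerate (ι := ι) (K := K)) N
  have h2 := Submodule.finrank_le N
  rw [Module.finrank_fintype_fun_eq_card] at h h2
  unfold annihilated
  omega

/-- The space of covectors spanned by the gradients at `x` of the members of an ideal. -/
noncomputable def conormal (I : Ideal (MvPolynomial ι k)) (x : ι → K) : Submodule K (ι → K) :=
  Submodule.span K (grad x '' (I : Set (MvPolynomial ι k)))

theorem mem_annihilated_conormal {I : Ideal (MvPolynomial ι k)} {x t : ι → K} :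
    t ∈ annihilated (conormal I x) ↔ ∀ f ∈ I, grad x f ⬝ᵥ t = 0 := by
  simp [conormal, mem_annihilated_span]

-- The derivation sends f(x) to ∇f(x) · t. It is well defined because two polynomials with the same
-- value at x differ by a relation, and t kills the gradients of relations.
open Algebra in
theorem exists_derivation_adjoin (x t : ι → K)
    (ht : ∀ f : MvPolynomial ι k, aeval x f = 0 → grad x f ⬝ᵥ t = 0) :
    ∃ d : Derivation k (adjoin k (Set.range x)) K,
      ∀ f : MvPolynomial ι k, ∀ a : adjoin k (Set.range x), (a : K) = aeval x f →
        d a = grad x f ⬝ᵥ t := by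
  have hs : ∀ a : adjoin k (Set.range x), ∃ f : MvPolynomial ι k, aeval x f = (a : K) := by
    intro a
    exact (adjoin_range_eq_range_aeval k x).le a.2
  choose g hg using hs
  have key : ∀ f f' : MvPolynomial ι k, aeval x f = aeval x f' →
      grad x f ⬝ᵥ t = grad x f' ⬝ᵥ t := by
    intro f f' h
    have := ht (f - f') (by simp [h])
    rw [grad_sub, sub_dotProduct] at this
    exact sub_eq_zero.mp this
  refine ⟨Derivation.mk'
    { toFun := fun a => grad x (g a) ⬝ᵥ t
      map_add' := fun a b => ?_
      map_smul' := fun c a => ?_ } ?_, ?_⟩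
  · rw [key (g (a + b)) (g a + g b) (by simp [hg]), grad_add, add_dotProduct]
  · rw [key (g (c • a)) (C c * g a) (by simp [hg, Algebra.smul_def]),
      grad_C_mul, smul_dotProduct]
    rfl
  · intro a b
    change grad x (g (a * b)) ⬝ᵥ t = a • (grad x (g b) ⬝ᵥ t) + b • (grad x (g a) ⬝ᵥ t)
    rw [key (g (a * b)) (g a * g b) (by simp [hg]), grad_mul, add_dotProduct, smul_dotProduct,
      smul_dotProduct, hg, hg]
    rfl
  · intro f a h
    exact key _ _ (by rw [hg, h])

/-- Tangent vectors to the locus of a generic point extend to derivations. -/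
theorem exists_derivation_of_tangent {K' : Type} [Field K'] [Algebra k K'] [Algebra K' K]
    [IsScalarTower k K' K] [CharZero k] (x t : ι → K')
    (ht : ∀ f : MvPolynomial ι k, aeval x f = 0 → grad x f ⬝ᵥ t = 0) :
    ∃ D : Derivation k K K, ∀ i, D (algebraMap K' K (x i)) = algebraMap K' K (t i) := by
  classical
  have hm : ∀ f : MvPolynomial ι k, aeval (fun i => algebraMap K' K (x i)) f =
      algebraMap K' K (aeval x f) := fun f => by
    rw [← IsScalarTower.coe_toAlgHom' k, ← AlgHom.comp_apply, comp_aeval]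
  have hg : ∀ f : MvPolynomial ι k, grad (fun i => algebraMap K' K (x i)) f =
      fun i => algebraMap K' K (grad x f i) := fun f => by
    ext i; simp [grad, hm]
  obtain ⟨d, hd⟩ := exists_derivation_adjoin (k := k) (fun i => algebraMap K' K (x i))
    (fun i => algebraMap K' K (t i)) (fun f hf => by
      rw [hm, map_eq_zero] at hf
      have := congrArg (algebraMap K' K) (ht f hf)
      simpa [hg, dotProduct, map_sum] using this)
  have : CharZero (Algebra.adjoin k (Set.range fun i => algebraMap K' K (x i))) :=
    charZero_of_injective_algebraMap (algebraMap k _).injective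
  obtain ⟨D, hD⟩ := Derivation.exists_extension k _ K d
  refine ⟨D, fun i => ?_⟩
  have h1 := hD ⟨algebraMap K' K (x i), Algebra.subset_adjoin ⟨i, rfl⟩⟩
  rw [hd (X i) _ (by simp), grad_X] at h1
  simpa using h1

/-- In characteristic zero the dimension of the generic tangent space is the transcendence degree
of the field generated by the generic point. -/
theorem finrank_genericTangent [CharZero k] (x : ι → K) :
    (Module.finrank K (annihilated (conormal (RingHom.ker (aeval x : MvPolynomial ι k →ₐ[k] K)) x))
      : Cardinal) = Algebra.trdeg k (Algebra.adjoin k (Set.range x)) := by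
  classical
  set A := Algebra.adjoin k (Set.range x) with hA
  set T := annihilated (conormal (RingHom.ker (aeval x : MvPolynomial ι k →ₐ[k] K)) x)
  have hcA : CharZero A := charZero_of_injective_algebraMap (algebraMap k _).injective
  have hcK : CharZero K := charZero_of_injective_algebraMap (algebraMap k _).injective
  have hft : Algebra.FiniteType k A :=
    (Subalgebra.fg_iff_finiteType _).mp ⟨Finset.univ.image x, by simp [hA]⟩
  obtain ⟨s, hs⟩ := exists_isTranscendenceBasis k A
  have hfin : Finite s := by
    rw [← Cardinal.mk_lt_aleph0_iff, hs.cardinalMk_eq_trdeg]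
    exact (trdeg_lt_aleph0_of_finiteType)
  have := Fintype.ofFinite s
  have hpre : ∀ j : s, ∃ f : MvPolynomial ι k, aeval x f = ((j : A) : K) := by
    intro j
    exact (Algebra.adjoin_range_eq_range_aeval k x).le (j : A).2
  choose g hg using hpre
  -- A tangent vector is paired with the differentials of a transcendence basis s. The map is
  -- injective because a derivation vanishing on s vanishes on everything algebraic over it, and
  -- surjective because a derivation can be prescribed freely on s.
  let E : T →ₗ[K] (s → K) :=
    { toFun := fun t j => grad x (g j) ⬝ᵥ (t : ι → K)
      map_add' := fun a b => by ext j; simp [dotProduct_add]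
      map_smul' := fun c a => by ext j; simp [dotProduct_smul] }
  have hE : Function.Bijective E := by
    constructor
    · rw [← LinearMap.ker_eq_bot, LinearMap.ker_eq_bot']
      intro t ht
      obtain ⟨d, hd⟩ := exists_derivation_adjoin (k := k) x t
        (fun f hf => mem_annihilated_conormal.mp t.2 f hf)
      obtain ⟨D, hD⟩ := Derivation.exists_extension k _ K d
      have h0 : ∀ a : Algebra.adjoin k (Set.range ((↑) : s → A)), D (algebraMap A K a) = 0 := by
        rintro ⟨a, ha⟩
        simp only
        induction ha using Algebra.adjoin_induction with
        | mem a ha =>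
          obtain ⟨j, rfl⟩ := ha
          rw [hD, hd (g j) _ (hg j).symm]
          exact congrFun ht j
        | algebraMap r => rw [← IsScalarTower.algebraMap_apply k A K]; simp
        | add a b _ _ ha hb => rw [map_add, map_add, ha, hb, add_zero]
        | mul a b _ _ ha hb => rw [map_mul, Derivation.leibniz, ha, hb]; simp
      have hi := hs.isAlgebraic
      ext i
      let a : A := ⟨x i, Algebra.subset_adjoin ⟨i, rfl⟩⟩
      have h1 : D (algebraMap A K a) = 0 := by
        refine Derivation.eq_zero_of_isAlgebraic (A := Algebra.adjoin k (Set.range ((↑) : s → A)))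
          D h0 ?_
        exact (hi.isAlgebraic a).algebraMap
      rw [hD, hd (X i) a (by simp [a]), grad_X] at h1
      simpa using h1
    · intro v
      have hinj : Function.Injective (algebraMap A K) := Subtype.val_injective
      have hind : AlgebraicIndependent k (fun j : s => algebraMap A K (j : A)) :=
        hs.1.map' (f := IsScalarTower.toAlgHom k A K) hinj
      obtain ⟨D, hD⟩ := exists_derivation_of_tangent (k := k) (K := K)
        (fun j : s => algebraMap A K (j : A)) v (fun f hf => by
          have : f = 0 := hind (by simpa using hf)
          simp [this, grad, dotProduct])
      refine ⟨⟨fun i => D (x i), mem_annihilated_conormal.mpr fun f hf => ?_⟩, ?_⟩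
      · rw [← Derivation.map_aeval_eq, (RingHom.mem_ker).mp hf, map_zero]
      · ext j
        change grad x (g j) ⬝ᵥ (fun i => D (x i)) = v j
        rw [← Derivation.map_aeval_eq, hg]
        exact hD j
  rw [(LinearEquiv.ofBijective E hE).finrank_eq, ← hs.cardinalMk_eq_trdeg]
  simp

end Gradient


/-! ### The normal space at the generic point -/

section GenericNormal

/-- A vector over a larger field which is annihilated by the vectors annihilated by `U` is a
combination of members of `U`. -/
theorem exists_coeff_of_annihilated {ι L K : Type} [Fintype ι] [DecidableEq ι] [Field L] [Field K]
    [Algebra L K] (U : Submodule L (ι → L)) (w : ι → K)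
    (h : ∀ t ∈ annihilated U, (w ⬝ᵥ fun i => algebraMap L K (t i)) = 0)
    {c : ℕ} (b : Module.Basis (Fin c) L U) :
    ∃ a : Fin c → K, w = ∑ j, a j • fun i => algebraMap L K ((b j : ι → L) i) := by
  -- With π a projection onto U over L, each coordinate of id - π is annihilated by U. The
  -- hypothesis then says that w is fixed by the extension of π to K, whose values are
  -- K-combinations of the basis.
  obtain ⟨π, hπ⟩ := LinearMap.exists_leftInverse_of_injective U.subtype (by simp)
  have hπ' : ∀ q ∈ U, (π q : ι → L) = q := fun q hq =>
    congrArg Subtype.val (LinearMap.congr_fun hπ ⟨q, hq⟩)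
  have key : ∀ j, w j = ∑ i, w i * algebraMap L K ((π (Pi.single i 1) : ι → L) j) := by
    intro j
    have ht : (fun i => (Pi.single i 1 : ι → L) j - (π (Pi.single i 1) : ι → L) j) ∈ annihilated U := by
      rw [mem_annihilated]
      intro q hq
      have h1 : q j = ∑ i, q i * (π (Pi.single i 1) : ι → L) j := by
        conv_lhs => rw [← hπ' q hq, pi_eq_sum_univ' q]
        simp [map_sum, map_smul, Finset.sum_apply]
      simp only [dotProduct, mul_sub, Finset.sum_sub_distrib, ← h1]
      simp [Pi.single_apply]
    have := h _ ht
    simp only [dotProduct, map_sub, mul_sub, Finset.sum_sub_distrib] at this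
    rw [sub_eq_zero] at this
    rw [← this]
    simp [Pi.single_apply, apply_ite (algebraMap L K)]
  refine ⟨fun l => ∑ i, w i * algebraMap L K (b.repr (π (Pi.single i 1)) l), ?_⟩
  ext j
  rw [key j]
  simp only [Finset.sum_apply, Pi.smul_apply, smul_eq_mul, Finset.sum_mul]
  rw [Finset.sum_comm]
  refine Finset.sum_congr rfl fun i _ => ?_
  have h2 := congrArg Subtype.val (b.sum_repr (π (Pi.single i 1)))
  have h3 := congrFun h2 j
  simp only [AddSubmonoidClass.coe_finsetSum, Submodule.coe_smul, Finset.sum_apply, Pi.smul_apply,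
    smul_eq_mul] at h3
  rw [← h3, map_sum, Finset.mul_sum]
  refine Finset.sum_congr rfl fun l _ => ?_
  rw [map_mul, mul_assoc]

variable {m : ℕ} {k L K : Type} [Field k] [Field L] [Field K] [Algebra k L] [Algebra k K]
  [Algebra L K] [IsScalarTower k L K]

variable (k) in
/-- The space spanned by the affine components of the gradients at `x` of the polynomials which
vanish at `x`. -/
noncomputable def tailConormal (x : Fin (m + 1) → L) : Submodule L (Fin m → L) :=
  (conormal (RingHom.ker (aeval x : MvPolynomial (Fin (m + 1)) k →ₐ[k] L)) x).map
    (LinearMap.funLeft L L Fin.succ)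

/-- Extend (0, t) to a derivation D of K and apply it to the sphere equation ⟨u, u⟩ = x_0² r. Here
Du = t - x_0 DO, and the terms in DO and Dr cancel by the conormality relation `hder`, which leaves
2 w · t = 0. -/
theorem dotProduct_tail_eq_zero [CharZero k] (x : Fin (m + 1) → L) (p : Fin (m + 1) → K)
    (M : Matrix (Fin m) (Fin m) k) (hM : M.IsSymm) (u w : Fin m → K)
    (hu : u = fun i => algebraMap L K (x i.succ) - algebraMap L K (x 0) * p i.succ)
    (hw : w = (M.map (algebraMap k K)).mulVec u)
    (hsph : w ⬝ᵥ u = algebraMap L K (x 0) ^ 2 * p 0)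
    (hder : ∀ D : Derivation k K K,
      2 * (w ⬝ᵥ fun i => D (p i.succ)) = - algebraMap L K (x 0) * D (p 0))
    (t : Fin m → L) (ht : t ∈ annihilated (tailConormal k x)) :
    (w ⬝ᵥ fun i => algebraMap L K (t i)) = 0 := by
  obtain ⟨D, hD⟩ := exists_derivation_of_tangent (k := k) (K := K) x (Fin.cons 0 t : Fin (m+1) → L)
    (fun f hf => by
      have h1 := mem_annihilated.mp ht (fun i => grad x f i.succ)
        ⟨grad x f, Submodule.subset_span ⟨f, hf, rfl⟩, rfl⟩
      simpa [dotProduct, Fin.sum_univ_succ] using h1)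
  have hD0 : D (algebraMap L K (x 0)) = 0 := by rw [hD]; simp
  have hDs : ∀ i : Fin m, D (algebraMap L K (x i.succ)) = algebraMap L K (t i) := by
    intro i; rw [hD]; simp
  have hDu : (fun i => D (u i)) = (fun i => algebraMap L K (t i)) -
      algebraMap L K (x 0) • fun i => D (p i.succ) := by
    ext i
    simp [hu, hDs, hD0, Algebra.smul_def]
  have hdot : ∀ v v' : Fin m → K, D (v ⬝ᵥ v') =
      (v ⬝ᵥ fun i => D (v' i)) + (fun i => D (v i)) ⬝ᵥ v' := by
    intro v v'
    simp only [dotProduct, map_sum, Derivation.leibniz, smul_eq_mul, ← Finset.sum_add_distrib]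
    refine Finset.sum_congr rfl fun i _ => by ring
  have hDw : (fun i => D (w i)) = (M.map (algebraMap k K)).mulVec (fun i => D (u i)) := by
    ext i
    simp [hw, Matrix.mulVec, dotProduct, map_sum]
  have hsym : (M.map (algebraMap k K)).mulVec (fun i => D (u i)) ⬝ᵥ u = w ⬝ᵥ fun i => D (u i) := by
    rw [hw, dotProduct_comm, Matrix.dotProduct_mulVec, ← Matrix.mulVec_transpose,
      ← Matrix.transpose_map, hM.eq]
  have h2 := congrArg D hsph
  rw [hdot, hDw, hsym, hDu, Derivation.leibniz, Derivation.leibniz_pow, hD0] at h2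
  have h3 := hder D
  simp only [dotProduct_sub, dotProduct_smul, smul_eq_mul, smul_zero, mul_zero, add_zero] at h2
  have hK : (2 : K) ≠ 0 := by
    have : CharZero K := charZero_of_injective_algebraMap (algebraMap k K).injective
    exact two_ne_zero
  refine (mul_eq_zero.mp ?_).resolve_left hK
  linear_combination h2 + algebraMap L K (x 0) * h3

/-- This is the dimension count which makes O generic in the normal space: the number of
coefficients is at most the transcendence degree of K over L, while K is algebraic over the field
they generate. -/
theorem exists_algebraicIndependent_conormal [CharZero k] (x : Fin (m + 1) → L)
    [Algebra.IsAlgebraic (Algebra.adjoin k (Set.range x)) L] (p : Fin (m + 1) → K)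
    (M : Matrix (Fin m) (Fin m) k) (hM : M.IsSymm) (hdet : IsUnit M.det) (h0 : x 0 ≠ 0)
    (u w : Fin m → K)
    (hu : u = fun i => algebraMap L K (x i.succ) - algebraMap L K (x 0) * p i.succ)
    (hw : w = (M.map (algebraMap k K)).mulVec u)
    (hsph : w ⬝ᵥ u = algebraMap L K (x 0) ^ 2 * p 0)
    (hder : ∀ D : Derivation k K K,
      2 * (w ⬝ᵥ fun i => D (p i.succ)) = - algebraMap L K (x 0) * D (p 0))
    (htr : ((m + 1 : ℕ) : Cardinal) ≤ Algebra.trdeg k K)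
    (halg : ∀ E : IntermediateField L K, (∀ i, p i ∈ E) → Algebra.IsAlgebraic E K) :
    ∃ (c : ℕ) (q : Fin c → Fin m → L) (a : Fin c → K), AlgebraicIndependent L a ∧
      Submodule.span L (Set.range q) = tailConormal k x ∧
      w = ∑ j, a j • fun i => algebraMap L K (q j i) := by
  classical
  set U := tailConormal k x with hU
  let b := Module.finBasis L U
  obtain ⟨a, ha⟩ := exists_coeff_of_annihilated U w
    (dotProduct_tail_eq_zero x p M hM u w hu hw hsph hder) b
  refine ⟨_, fun j => b j, a, ?_, ?_, ha⟩
  -- E contains w, hence u = M⁻¹w, hence r by the sphere equation and O by the definition of u. So K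
  -- is algebraic over E.
  · let E := IntermediateField.adjoin L (Set.range a)
    have haE : ∀ j, a j ∈ E := fun j => IntermediateField.subset_adjoin L _ ⟨j, rfl⟩
    have hL : ∀ l : L, algebraMap L K l ∈ E := fun l => E.algebraMap_mem l
    have hk : ∀ l : k, algebraMap k K l ∈ E := fun l => by
      rw [IsScalarTower.algebraMap_apply k L K]; exact hL _
    have hwE : ∀ i, w i ∈ E := fun i => by
      rw [ha, Finset.sum_apply]
      exact sum_mem fun j _ => mul_mem (haE j) (hL _)
    have hu' : u = (M⁻¹.map (algebraMap k K)).mulVec w := by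
      rw [hw, Matrix.mulVec_mulVec, ← Matrix.map_mul, Matrix.nonsing_inv_mul _ hdet]
      simp
    have huE : ∀ i, u i ∈ E := fun i => by
      rw [hu', Matrix.mulVec, dotProduct]
      exact sum_mem fun j _ => mul_mem (hk _) (hwE j)
    have h0' : algebraMap L K (x 0) ≠ 0 := by simpa using h0
    have hpE : ∀ i, p i ∈ E := by
      refine Fin.cases ?_ fun i => ?_
      · have : p 0 = (w ⬝ᵥ u) / (algebraMap L K (x 0) ^ 2) := by
          rw [hsph]; field_simp
        rw [this]
        exact div_mem (sum_mem fun j _ => mul_mem (hwE j) (huE j)) (pow_mem (hL _) _)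
      · have : p i.succ = (algebraMap L K (x i.succ) - u i) / algebraMap L K (x 0) := by
          rw [hu]; field_simp; ring
        rw [this]
        exact div_mem (sub_mem (hL _) (huE i)) (hL _)
    have h1 := halg E hpE
    have h2 : Algebra.IsAlgebraic (Algebra.adjoin L (Set.range a)) K :=
      IntermediateField.isAlgebraic_adjoin_iff_top.mp h1
    -- The transcendence degree of L is the dimension of the generic tangent space, that is m + 1
    -- minus the rank of the conormal space. So K has degree at least that rank over L, and the
    -- tails span no larger a space.
    refine (Algebra.IsAlgebraic.isTranscendenceBasis_of_le_trdeg_of_finite L a ?_).1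
    have h3 := finrank_genericTangent (k := k) x
    have h4 : Algebra.trdeg k L = Algebra.trdeg k (Algebra.adjoin k (Set.range x)) := by
      have := trdeg_add_eq k (Algebra.adjoin k (Set.range x)) (A := L)
      rw [← this, trdeg_eq_zero (R := Algebra.adjoin k (Set.range x)), add_zero]
    have h5 := trdeg_add_eq k L (A := K)
    rw [h4, ← h3] at h5
    have h6 := finrank_annihilated
      (conormal (RingHom.ker (aeval x : MvPolynomial (Fin (m + 1)) k →ₐ[k] L)) x)
    have h7 : Module.finrank L U ≤ Module.finrank L
      (conormal (RingHom.ker (aeval x : MvPolynomial (Fin (m + 1)) k →ₐ[k] L)) x) :=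
      Submodule.finrank_map_le _ _
    rw [Fintype.card_fin] at h6
    rw [← h5] at htr
    rw [Cardinal.mk_fin]
    refine le_trans (Nat.cast_le.mpr h7) ?_
    replace htr := (congrArg Nat.cast h6).le.trans htr
    rw [Nat.cast_add, add_comm, add_comm _ (Algebra.trdeg L K)] at htr
    exact (Cardinal.add_le_add_iff_of_lt_aleph0 (Cardinal.natCast_lt_aleph0)).mp htr
  · have := congrArg (Submodule.map U.subtype) b.span_eq
    rw [Submodule.map_span, ← Set.range_comp, Submodule.map_top, Submodule.range_subtype] at this
    exact this

/-- Polynomials which vanish on the cone over the generic `p` vanish on the normal space. -/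
theorem aeval_normal_eq_zero [CharZero k] (x : Fin (m + 1) → L) (p : Fin (m + 1) → K)
    (M : Matrix (Fin m) (Fin m) k) (hdet : IsUnit M.det) (u w : Fin m → K)
    (hu : u = fun i => algebraMap L K (x i.succ) - algebraMap L K (x 0) * p i.succ)
    (hw : w = (M.map (algebraMap k K)).mulVec u)
    {c : ℕ} (q : Fin c → Fin m → L) (a : Fin c → K) (ha : AlgebraicIndependent L a)
    (haq : w = ∑ j, a j • fun i => algebraMap L K (q j i))
    (g : MvPolynomial (Fin (m + 1)) k)
    (hg : ∀ τ : K, aeval (Fin.cons τ fun i => τ * p i.succ : Fin (m + 1) → K) g = 0)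
    (e : L) (v : Fin m → L) (hv : v ∈ Submodule.span L (Set.range q)) :
    aeval (Fin.cons (e * x 0) fun i => e * x i.succ +
      (M⁻¹.map (algebraMap k L)).mulVec v i : Fin (m + 1) → L) g = 0 := by
  classical
  have hne : ∀ e : L, e ≠ 0 → aeval (Fin.cons (e * x 0) fun i => e * x i.succ +
      (M⁻¹.map (algebraMap k L)).mulVec v i : Fin (m + 1) → L) g = 0 := by
    intro e he
    obtain ⟨β, rfl⟩ := (Submodule.mem_span_range_iff_exists_fun L).mp hv
    let r : Fin c → Fin m → L := fun j => (M⁻¹.map (algebraMap k L)).mulVec (q j)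
    -- The coefficients a become indeterminates. At a this point is e x_0 (1, O), where g vanishes,
    -- so g(y) = 0 by algebraic independence. At -β/e it is the required normal vector, whence the
    -- need for e ≠ 0.
    let y : Fin (m + 1) → MvPolynomial (Fin c) L := Fin.cons (C (e * x 0)) fun i =>
      C (e * x i.succ) - ∑ j, X j * C (e * r j i)
    have hu' : u = (M⁻¹.map (algebraMap k K)).mulVec w := by
      rw [hw, Matrix.mulVec_mulVec, ← Matrix.map_mul, Matrix.nonsing_inv_mul _ hdet]
      simp
    have hur : ∀ i, u i = ∑ j, a j * algebraMap L K (r j i) := by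
      intro i
      rw [hu', haq]
      simp only [Matrix.mulVec, dotProduct, Matrix.map_apply, Finset.sum_apply, Pi.smul_apply,
        smul_eq_mul, r, map_sum, map_mul, Finset.mul_sum, ← IsScalarTower.algebraMap_apply k L K]
      rw [Finset.sum_comm]
      exact Finset.sum_congr rfl fun j _ => Finset.sum_congr rfl fun l _ => by ring
    have hcomp : ∀ {E : Type} [Field E] [Algebra k E] [Algebra L E] [IsScalarTower k L E]
        (z : Fin c → E), aeval z (aeval y g) = aeval (fun i => aeval z (y i)) g := by
      intro E _ _ _ _ z
      have := comp_aeval_apply (R := k) (f := y)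
        ((aeval z : MvPolynomial (Fin c) L →ₐ[L] E).restrictScalars k) g
      simpa using this
    have h0 : aeval y g = 0 := by
      apply ha
      rw [map_zero, hcomp, ← hg (algebraMap L K (e * x 0))]
      congr 2
      ext i
      refine Fin.cases ?_ (fun i => ?_) i
      · simp [y]
      · simp only [Fin.cons_succ, map_sub, map_sum, map_mul, aeval_X, algHom_C, y]
        have h1 := hur i
        rw [hu] at h1
        have h2 : ∑ j, a j * (algebraMap L K e * algebraMap L K (r j i)) =
            algebraMap L K e * ∑ j, a j * algebraMap L K (r j i) := by
          rw [Finset.mul_sum]; exact Finset.sum_congr rfl fun j _ => by ring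
        rw [h2, ← h1]
        ring
    have h1 := hcomp (fun j => - (β j / e))
    rw [h0, map_zero] at h1
    rw [h1]
    congr 2
    ext i
    refine Fin.cases ?_ (fun i => ?_) i
    · simp [y]
    · simp only [Fin.cons_succ, map_sub, map_sum, map_mul, aeval_X, algHom_C, y,
        Algebra.algebraMap_self, RingHom.id_apply]
      rw [sub_eq_add_neg, ← Finset.sum_neg_distrib]
      congr 1
      simp only [Matrix.mulVec, dotProduct, Matrix.map_apply, Finset.sum_apply, Pi.smul_apply,
        smul_eq_mul, r, Finset.mul_sum]
      rw [Finset.sum_comm]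
      refine Finset.sum_congr rfl fun j _ => ?_
      rw [← Finset.sum_neg_distrib]
      refine Finset.sum_congr rfl fun l _ => ?_
      field_simp
  -- The case e = 0, a normal vector at infinity, follows because the value of g is a polynomial in
  -- e vanishing at every e ≠ 0.
  let Q : Polynomial L := aeval (Fin.cons (Polynomial.X * Polynomial.C (x 0)) fun i =>
    Polynomial.X * Polynomial.C (x i.succ) +
      Polynomial.C ((M⁻¹.map (algebraMap k L)).mulVec v i) : Fin (m + 1) → Polynomial L) g
  have hQ : ∀ e : L, Q.eval e = aeval (Fin.cons (e * x 0) fun i => e * x i.succ +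
      (M⁻¹.map (algebraMap k L)).mulVec v i : Fin (m + 1) → L) g := by
    intro e
    have := comp_aeval_apply (R := k) (f := (Fin.cons (Polynomial.X * Polynomial.C (x 0)) fun i =>
      Polynomial.X * Polynomial.C (x i.succ) +
        Polynomial.C ((M⁻¹.map (algebraMap k L)).mulVec v i) : Fin (m + 1) → Polynomial L))
      ((Polynomial.aeval e).restrictScalars k) g
    rw [AlgHom.restrictScalars_apply, Polynomial.coe_aeval_eq_eval] at this
    rw [this]
    congr 2
    ext i
    refine Fin.cases ?_ (fun i => ?_) i <;> simp only [Fin.cons_zero, Fin.cons_succ] <;>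
      simp [mul_comm e]
  have : CharZero L := charZero_of_injective_algebraMap (algebraMap k L).injective
  have hQ0 : Q = 0 := by
    refine Polynomial.eq_zero_of_infinite_isRoot Q ?_
    refine Set.Infinite.mono (s := {e : L | e ≠ 0}) (fun e he => ?_) ?_
    · rw [Set.mem_ofPred_eq, Polynomial.IsRoot, hQ]
      exact hne e he
    · exact (Set.finite_singleton (0 : L)).infinite_compl
  rw [← hQ, hQ0, Polynomial.eval_zero]

end GenericNormal


/-! ### Specialization of the generic point -/

section Specialization

variable {ι k A : Type} [Field k] [CommRing A] [IsDomain A] [Algebra k A]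

/-- A relation of linear dependence over the fraction field specializes on a nonempty open set. -/
theorem exists_smul_mem_span_of_mem_span {K : Type} [Field K] [Algebra A K] [IsFractionRing A K]
    {c : ℕ} (q : Fin c → ι → A) (w : ι → A)
    (h : (fun i => algebraMap A K (w i)) ∈
      Submodule.span K (Set.range fun j i => algebraMap A K (q j i))) :
    ∃ r : A, r ≠ 0 ∧ ∃ b : Fin c → A, r • w = ∑ j, b j • q j := by
  obtain ⟨β, hβ⟩ := (Submodule.mem_span_range_iff_exists_fun K).mp h
  obtain ⟨r, hr⟩ := IsLocalization.exist_integer_multiples_of_finite (nonZeroDivisors A) β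
  choose b hb using hr
  refine ⟨r, nonZeroDivisors.coe_ne_zero r, b, ?_⟩
  ext i
  apply IsFractionRing.injective A K
  have := congrFun hβ i
  simp only [Finset.sum_apply, Pi.smul_apply, smul_eq_mul] at this ⊢
  rw [map_mul, ← this, map_sum, Finset.mul_sum]
  refine Finset.sum_congr rfl fun j _ => ?_
  rw [map_mul, hb, Algebra.smul_def, mul_assoc]

variable [Fintype ι]

/-- Vectors which are linearly independent over the fraction field have a left inverse up to a
denominator. -/
theorem exists_leftInverse_of_linearIndependent {K : Type} [Field K] [Algebra A K]
    [IsFractionRing A K] {c : ℕ} (q : Fin c → ι → A)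
    (h : LinearIndependent K fun j i => algebraMap A K (q j i)) :
    ∃ r : A, r ≠ 0 ∧ ∃ n : Fin c → ι → A, ∀ j l,
      ∑ i, n l i * q j i = if l = j then r else 0 := by
  classical
  obtain ⟨N, hN⟩ := LinearMap.exists_leftInverse_of_injective
    (Fintype.linearCombination K fun j i => algebraMap A K (q j i))
    (by rw [LinearMap.ker_eq_bot]; exact h.fintypeLinearCombination_injective)
  have hN1 : ∀ j, N (fun i => algebraMap A K (q j i)) = Pi.single j 1 := fun j => by
    have := LinearMap.congr_fun hN (Pi.single j 1)
    simpa [Fintype.linearCombination_apply_single] using this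
  obtain ⟨r, hr⟩ := IsLocalization.exist_integer_multiples_of_finite (nonZeroDivisors A)
    (fun li : Fin c × ι => N (Pi.single li.2 1) li.1)
  choose n hn using hr
  have key : ∀ j l, ∑ i, n (l, i) * q j i = if l = j then (r : A) else 0 := by
    intro j l
    apply IsFractionRing.injective A K
    have h1 := congrFun (hN1 j) l
    rw [pi_eq_sum_univ' (fun i => algebraMap A K (q j i))] at h1
    simp only [map_sum, map_smul, Finset.sum_apply, Pi.smul_apply, smul_eq_mul] at h1
    rw [map_sum]
    have h2 : ∀ i, algebraMap A K (n (l, i) * q j i) =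
        algebraMap A K r * (algebraMap A K (q j i) * N (Pi.single i 1) l) := by
      intro i
      rw [map_mul, hn, Algebra.smul_def]; ring
    rw [Finset.sum_congr rfl fun i _ => h2 i, ← Finset.mul_sum, h1]
    simp [Pi.single_apply, apply_ite (algebraMap A K)]
  exact ⟨r, nonZeroDivisors.coe_ne_zero r, fun l i => n (l, i), key⟩

/-- Linear independence over the fraction field specializes on a nonempty open set. -/
theorem exists_linearIndependent_specialization {K : Type} [Field K] [Algebra A K]
    [IsFractionRing A K] {c : ℕ} (q : Fin c → ι → A)
    (h : LinearIndependent K fun j i => algebraMap A K (q j i)) :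
    ∃ r : A, r ≠ 0 ∧ ∀ (E : Type) [Field E] (ε : A →+* E), ε r ≠ 0 →
      LinearIndependent E fun j i => ε (q j i) := by
  classical
  obtain ⟨r, hr, n, key⟩ := exists_leftInverse_of_linearIndependent q h
  refine ⟨r, hr, fun E _ ε hε => ?_⟩
  rw [Fintype.linearIndependent_iff]
  intro γ hγ l
  have h3 : ∑ i, ε (n l i) * (∑ j, γ j * ε (q j i)) = 0 := by
    refine Finset.sum_eq_zero fun i _ => ?_
    have := congrFun hγ i
    simp only [Finset.sum_apply, Pi.smul_apply, smul_eq_mul, Pi.zero_apply] at this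
    rw [this, mul_zero]
  have h4 : ∑ i, ε (n l i) * (∑ j, γ j * ε (q j i)) =
      ∑ j, γ j * ε (∑ i, n l i * q j i) := by
    simp only [Finset.mul_sum, map_sum, map_mul]
    rw [Finset.sum_comm]
    exact Finset.sum_congr rfl fun i _ => Finset.sum_congr rfl fun j _ => by ring
  rw [h4] at h3
  simp only [key, apply_ite ε, map_zero] at h3
  simpa [hε] using h3

/-- There are finitely many equations whose gradients are a basis of the conormal space at the
generic point and at all points of a nonempty open set. -/
theorem exists_conormal_frame (x : ι → A) :
    ∃ (d : ℕ) (f : Fin d → MvPolynomial ι k) (h : A), h ≠ 0 ∧ (∀ j, aeval x (f j) = 0) ∧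
      ∀ (E : Type) [Field E] [Algebra k E] (ε : A →ₐ[k] E), ε h ≠ 0 →
        LinearIndependent E (fun j => grad (fun i => ε (x i)) (f j)) ∧
        conormal (RingHom.ker (aeval x : MvPolynomial ι k →ₐ[k] A)) (fun i => ε (x i)) =
          Submodule.span E (Set.range fun j => grad (fun i => ε (x i)) (f j)) := by
  classical
  set I := RingHom.ker (aeval x : MvPolynomial ι k →ₐ[k] A) with hI
  let K := FractionRing A
  let φ : A →ₐ[k] K := IsScalarTower.toAlgHom k A K
  let X : ι → K := fun i => φ (x i)
  have hgX : ∀ f : MvPolynomial ι k, grad X f = fun i => algebraMap A K (grad x f i) :=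
    fun f => grad_map x φ f
  -- The basis is chosen among the gradients themselves, so that its members come from equations
  -- which can be specialized.
  obtain ⟨b, hbs, hbspan, hbli⟩ := exists_linearIndependent K
    (grad X '' (I : Set (MvPolynomial ι k)))
  have hfin : Finite b := hbli.finite
  have := Fintype.ofFinite b
  let e := Fintype.equivFin b
  choose f0 hf0I hf0 using fun j : Fin (Fintype.card b) => hbs (e.symm j).2
  have hf0' : (fun j => grad X (f0 j)) = (fun j : b => (j : ι → K)) ∘ e.symm := by
    ext1 j; exact hf0 j
  have hli : LinearIndependent K (fun j => grad X (f0 j)) := by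
    rw [hf0']
    exact hbli.comp _ e.symm.injective
  have hspan : Submodule.span K (Set.range fun j => grad X (f0 j)) = conormal I X := by
    rw [hf0', e.symm.surjective.range_comp, Subtype.range_coe, hbspan, conormal]
  simp only [hgX] at hli hspan
  obtain ⟨r1, hr1, hr1'⟩ := exists_linearIndependent_specialization _ hli
  have hfg : I.FG := (isNoetherianRing_iff_ideal_fg _).mp inferInstance I
  obtain ⟨G, hG⟩ := hfg
  have hGI : ∀ g ∈ G, g ∈ I := fun g hg => hG ▸ Ideal.subset_span hg
  -- The ideal is finitely generated, so finitely many denominators suffice; their product, times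
  -- the one for independence, defines the open set.
  have hrel : ∀ g ∈ G, ∃ r : A, r ≠ 0 ∧ ∃ b : Fin (Fintype.card b) → A,
      r • grad x g = ∑ j, b j • grad x (f0 j) := fun g hg => by
    refine exists_smul_mem_span_of_mem_span (K := K) _ _ ?_
    rw [hspan, ← hgX]
    exact Submodule.subset_span ⟨g, hGI g hg, rfl⟩
  choose! r hr β hβ using hrel
  refine ⟨_, f0, r1 * ∏ g ∈ G, r g, mul_ne_zero hr1 (Finset.prod_ne_zero_iff.mpr hr), hf0I, ?_⟩
  intro E _ _ ε hε
  rw [map_mul, map_prod] at hε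
  have hε1 := left_ne_zero_of_mul hε
  have hε2 := Finset.prod_ne_zero_iff.mp (right_ne_zero_of_mul hε)
  have hgE : ∀ f : MvPolynomial ι k, grad (fun i => ε (x i)) f = fun i => ε (grad x f i) :=
    fun f => grad_map x ε f
  refine ⟨by simpa only [hgE, RingHom.coe_coe] using hr1' E (ε : A →+* E) hε1, le_antisymm ?_ ?_⟩
  · rw [conormal, Submodule.span_le]
    rintro _ ⟨f, hf, rfl⟩
    have hf' : f ∈ Submodule.span (MvPolynomial ι k) (G : Set (MvPolynomial ι k)) := by
      rw [← Ideal.span, hG]; exact hf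
    have : f ∈ I ∧ grad (fun i => ε (x i)) f ∈
        Submodule.span E (Set.range fun j => grad (fun i => ε (x i)) (f0 j)) := by
      clear hf
      induction hf' using Submodule.span_induction with
      | mem g hg =>
        refine ⟨hGI g hg, ?_⟩
        have h1 : ε (r g) • grad (fun i => ε (x i)) g =
            ∑ j, ε (β g j) • grad (fun i => ε (x i)) (f0 j) := by
          ext i
          have := congrArg ε (congrFun (hβ g hg) i)
          simpa [hgE, map_sum] using this
        rw [← inv_smul_smul₀ (hε2 g hg) (grad (fun i => ε (x i)) g), h1]
        exact Submodule.smul_mem _ _ (Submodule.sum_mem _ fun j _ => Submodule.smul_mem _ _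
          (Submodule.subset_span ⟨j, rfl⟩))
      | zero => exact ⟨I.zero_mem, by rw [show (0 : MvPolynomial ι k) = C 0 by simp, grad_C]; simp⟩
      | add a b _ _ ha hb =>
        exact ⟨I.add_mem ha.1 hb.1, by rw [grad_add]; exact Submodule.add_mem _ ha.2 hb.2⟩
      | smul a g _ hg =>
        refine ⟨I.mul_mem_left a hg.1, ?_⟩
        -- As g vanishes at the point, the gradient of a multiple of g is there a multiple of that
        -- of g. Generators are therefore enough.
        have h0 : aeval (fun i => ε (x i)) g = 0 := by
          rw [← comp_aeval_apply, (RingHom.mem_ker).mp hg.1, map_zero]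
        rw [smul_eq_mul, grad_mul, h0, zero_smul, add_zero]
        exact Submodule.smul_mem _ _ hg.2
    exact this.2
  · refine Submodule.span_le.mpr ?_
    rintro _ ⟨j, rfl⟩
    exact Submodule.subset_span ⟨_, hf0I j, rfl⟩

/-- The number of members of a conormal frame. -/
theorem natCast_add_trdeg_eq_card [CharZero k] (x : ι → A) (hx : Algebra.adjoin k (Set.range x) = ⊤)
    {d : ℕ} (f : Fin d → MvPolynomial ι k)
    (hli : LinearIndependent (FractionRing A)
      (fun j => grad (fun i => algebraMap A (FractionRing A) (x i)) (f j)))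
    (hspan : conormal (RingHom.ker (aeval x : MvPolynomial ι k →ₐ[k] A))
        (fun i => algebraMap A (FractionRing A) (x i)) =
      Submodule.span (FractionRing A)
        (Set.range fun j => grad (fun i => algebraMap A (FractionRing A) (x i)) (f j))) :
    ∃ n : ℕ, Algebra.trdeg k A = n ∧ n + d = Fintype.card ι := by
  set K := FractionRing A
  set X : ι → K := fun i => algebraMap A K (x i)
  have hker : RingHom.ker (aeval X : MvPolynomial ι k →ₐ[k] K) =
      RingHom.ker (aeval x : MvPolynomial ι k →ₐ[k] A) := by
    ext f
    rw [RingHom.mem_ker, RingHom.mem_ker, ← map_eq_zero_iff _ (IsFractionRing.injective A K),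
      ← IsScalarTower.coe_toAlgHom' k, comp_aeval_apply]
    rfl
  have h1 := finrank_genericTangent (k := k) X
  rw [hker] at h1
  have h2 := finrank_annihilated (conormal (RingHom.ker (aeval x : MvPolynomial ι k →ₐ[k] A)) X)
  have h3 : Module.finrank K
      (conormal (RingHom.ker (aeval x : MvPolynomial ι k →ₐ[k] A)) X) = d := by
    rw [hspan, finrank_span_eq_card hli, Fintype.card_fin]
  refine ⟨_, ?_, h3 ▸ h2⟩
  rw [h1]
  have hinj : Function.Injective (IsScalarTower.toAlgHom k A K) := IsFractionRing.injective A K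
  rw [(AlgEquiv.ofInjective _ hinj).trdeg_eq]
  have : (IsScalarTower.toAlgHom k A K).range = Algebra.adjoin k (Set.range X) := by
    rw [← Algebra.map_top, ← hx, AlgHom.map_adjoin, ← Set.range_comp]
    rfl
  rw [this]

end Specialization

/-! ### Coordinate rings and generic smoothness of affine varieties -/

section Smooth

variable {ι : Type}

/-- The coordinate functions. -/
noncomputable def coordFun (S : Set (ι → ℂ)) : ι → CoordRing S := fun i => Ideal.Quotient.mk _ (X i)

theorem aeval_coordFun (S : Set (ι → ℂ)) (f : MvPolynomial ι ℂ) :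
    aeval (coordFun S) f = Ideal.Quotient.mk (vanishingIdeal ℂ S) f := by
  have : (Ideal.Quotient.mkₐ ℂ (vanishingIdeal ℂ S)) = aeval (coordFun S) := by
    apply MvPolynomial.algHom_ext
    intro i
    simp [coordFun]
  rw [← this]
  rfl

theorem ker_aeval_coordFun (S : Set (ι → ℂ)) :
    RingHom.ker (aeval (coordFun S) : MvPolynomial ι ℂ →ₐ[ℂ] CoordRing S) =
      vanishingIdeal ℂ S := by
  ext f
  rw [RingHom.mem_ker, aeval_coordFun, Ideal.Quotient.eq_zero_iff_mem]

theorem adjoin_coordFun (S : Set (ι → ℂ)) : Algebra.adjoin ℂ (Set.range (coordFun S)) = ⊤ := by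
  rw [Algebra.adjoin_range_eq_range_aeval, AlgHom.range_eq_top]
  intro a
  obtain ⟨f, rfl⟩ := Ideal.Quotient.mk_surjective a
  exact ⟨f, aeval_coordFun S f⟩

/-- Evaluation of polynomial functions at a point. -/
noncomputable def evalAt {S : Set (ι → ℂ)} {p : ι → ℂ} (hp : p ∈ S) : CoordRing S →ₐ[ℂ] ℂ :=
  Ideal.Quotient.liftₐ _ (aeval p) fun _ hf => hf p hp

@[simp] theorem evalAt_coordFun {S : Set (ι → ℂ)} {p : ι → ℂ} (hp : p ∈ S) (i : ι) :
    evalAt hp (coordFun S i) = p i := by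
  change aeval p (X i) = p i
  simp

theorem evalAt_mk {S : Set (ι → ℂ)} {p : ι → ℂ} (hp : p ∈ S) (f : MvPolynomial ι ℂ) :
    evalAt hp (Ideal.Quotient.mk _ f) = aeval p f := rfl

variable [Fintype ι]

theorem mem_tangentSpace {S : Set (ι → ℂ)} {p t : ι → ℂ} :
    t ∈ tangentSpace S p ↔ ∀ f ∈ vanishingIdeal ℂ S, grad p f ⬝ᵥ t = 0 := Iff.rfl

theorem tangentSpace_eq_annihilated (S : Set (ι → ℂ)) (p : ι → ℂ) :
    tangentSpace S p = annihilated (conormal (vanishingIdeal ℂ S) p) := by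
  ext t
  rw [mem_tangentSpace, mem_annihilated_conormal]

/-- The points outside a proper closed subset of an irreducible set are smooth. -/
theorem exists_smooth_of_isPrime (S : Set (ι → ℂ)) [hS : (vanishingIdeal ℂ S).IsPrime] :
    ∃ H : MvPolynomial ι ℂ, H ∉ vanishingIdeal ℂ S ∧
      ∀ p ∈ S, aeval p H ≠ 0 → IsSmoothPoint S p := by
  obtain ⟨d, f, h, hh, hf, hE⟩ := exists_conormal_frame (k := ℂ) (coordFun S)
  rw [ker_aeval_coordFun] at hE
  have h1 := hE (FractionRing (CoordRing S)) (IsScalarTower.toAlgHom ℂ _ _)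
    (by simpa using hh)
  obtain ⟨n, hn, hnd⟩ := natCast_add_trdeg_eq_card (k := ℂ) (coordFun S) (adjoin_coordFun S) f h1.1
    (by rw [ker_aeval_coordFun]; exact h1.2)
  obtain ⟨H, rfl⟩ := Ideal.Quotient.mk_surjective h
  refine ⟨H, fun hH => hh (Ideal.Quotient.eq_zero_iff_mem.mpr hH), fun p hp hpH => ⟨hp, ?_⟩⟩
  -- The frame keeps its d independent gradients at p, so the tangent space at p has the generic
  -- dimension.
  obtain ⟨h2, h3⟩ := hE ℂ (evalAt hp) hpH
  simp only [evalAt_coordFun] at h2 h3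
  have h4 := finrank_annihilated (conormal (vanishingIdeal ℂ S) p)
  rw [h3, finrank_span_eq_card h2, Fintype.card_fin, ← h3, ← tangentSpace_eq_annihilated] at h4
  rw [dimension, hn, ← Module.finrank_eq_rank]
  have h5 : Module.finrank ℂ (tangentSpace S p) + d = Fintype.card ι := h4
  congr 1
  omega

end Smooth


/-! ### Cones over subsets of projective space -/

section Cone

variable {m : ℕ}

theorem smul_mem_cone {X : Set (P m)} {v : V m} (hv : v ∈ cone X) {c : ℂ} (hc : c ≠ 0) :
    c • v ∈ cone X := by
  obtain ⟨h, hX⟩ := hv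
  refine ⟨smul_ne_zero hc h, ?_⟩
  rwa [(Projectivization.mk_eq_mk_iff' ℂ _ _ (smul_ne_zero hc h) h).mpr ⟨c, rfl⟩]

theorem smul_mem_cone_iff {X : Set (P m)} {v : V m} {c : ℂ} (hc : c ≠ 0) :
    c • v ∈ cone X ↔ v ∈ cone X := by
  refine ⟨fun h => ?_, fun h => smul_mem_cone h hc⟩
  simpa [smul_smul, inv_mul_cancel₀ hc] using smul_mem_cone h (inv_ne_zero hc)

theorem rep_mem_cone_iff {X : Set (P m)} {x : P m} : x.rep ∈ cone X ↔ x ∈ X := by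
  simp [cone, x.rep_nonzero]

theorem mem_cone_mk {X : Set (P m)} {v : V m} (hv : v ≠ 0) :
    v ∈ cone X ↔ Projectivization.mk ℂ v hv ∈ X :=
  ⟨fun h => h.2, fun h => ⟨hv, h⟩⟩

theorem mem_cone_singleton {x : P m} {v : V m} : v ∈ cone {x} ↔ ∃ c : ℂ, c ≠ 0 ∧ v = c • x.rep := by
  constructor
  · rintro ⟨h, hx⟩
    rw [Set.mem_singleton_iff] at hx
    obtain ⟨a, ha⟩ := (Projectivization.mk_eq_mk_iff ℂ v x.rep h x.rep_nonzero).mp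
      (by rw [hx, x.mk_rep])
    exact ⟨a, a.ne_zero, ha.symm⟩
  · rintro ⟨c, hc, rfl⟩
    exact smul_mem_cone (rep_mem_cone_iff.mpr (Set.mem_singleton x)) hc

theorem exists_rep_mk_eq {v : V m} (hv : v ≠ 0) :
    ∃ c : ℂ, c ≠ 0 ∧ (Projectivization.mk ℂ v hv).rep = c • v := by
  obtain ⟨a, ha⟩ := Projectivization.exists_smul_eq_mk_rep ℂ v hv
  exact ⟨a, a.ne_zero, ha.symm⟩

/-- The polynomial `f (c x)`. -/
noncomputable def dilate {ι : Type} (c : ℂ) (f : MvPolynomial ι ℂ) : MvPolynomial ι ℂ :=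
  aeval (fun i => C c * X i) f

theorem aeval_dilate {ι : Type} (c : ℂ) (f : MvPolynomial ι ℂ) (v : ι → ℂ) :
    aeval v (dilate c f) = aeval (c • v) f := by
  rw [dilate, comp_aeval_apply]
  congr 2
  ext i
  simp

theorem dilate_mem {X : Set (P m)} {f : MvPolynomial (Fin (m + 1)) ℂ}
    (hf : f ∈ vanishingIdeal ℂ (cone X)) {c : ℂ} (hc : c ≠ 0) :
    dilate c f ∈ vanishingIdeal ℂ (cone X) := fun v hv => by
  rw [aeval_dilate]
  exact hf _ (smul_mem_cone hv hc)

theorem grad_dilate {ι : Type} [Fintype ι] (c : ℂ) (f : MvPolynomial ι ℂ) (v : ι → ℂ) :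
    grad v (dilate c f) = c • grad (c • v) f := by
  classical
  ext i
  have h1 := Derivation.map_aeval_eq (fun j => C c * X j) (pderiv (R := ℂ) i) f
  rw [grad, dilate, h1]
  have h2 : (fun j => pderiv i (C c * X j : MvPolynomial ι ℂ)) = Pi.single i (C c) := by
    ext1 j
    rw [pderiv_C_mul, pderiv_X]
    by_cases h : j = i
    · subst h; simp
    · simp [h]
  rw [h2, dotProduct_single, map_mul, grad, comp_aeval_apply]
  simp only [map_mul, algHom_C, aeval_X]
  rw [mul_comm]
  rfl

theorem mem_projClosure_iff {X : Set (P m)} {x : P m} :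
    x ∈ projClosure X ↔ ∀ f ∈ vanishingIdeal ℂ (cone X), aeval x.rep f = 0 := by
  constructor
  · intro h f hf
    exact h f hf _ (rep_mem_cone_iff.mpr rfl)
  · intro h f hf v hv
    obtain ⟨c, hc, rfl⟩ := mem_cone_singleton.mp hv
    have := h _ (dilate_mem hf hc)
    rwa [aeval_dilate] at this

theorem mem_cone_projClosure_iff {X : Set (P m)} {v : V m} :
    v ∈ cone (projClosure X) ↔ v ≠ 0 ∧ ∀ f ∈ vanishingIdeal ℂ (cone X), aeval v f = 0 := by
  constructor
  · rintro ⟨h, hv⟩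
    refine ⟨h, fun f hf => hv f hf v ⟨h, rfl⟩⟩
  · rintro ⟨h, hv⟩
    refine ⟨h, mem_projClosure_iff.mpr fun f hf => ?_⟩
    obtain ⟨c, hc, hr⟩ := exists_rep_mk_eq h
    rw [hr, ← aeval_dilate]
    exact hv _ (dilate_mem hf hc)

theorem subset_projClosure (X : Set (P m)) : X ⊆ projClosure X := fun _ hx =>
  mem_projClosure_iff.mpr fun _ hf => hf _ (rep_mem_cone_iff.mpr hx)

theorem vanishingIdeal_cone_projClosure (X : Set (P m)) :
    vanishingIdeal ℂ (cone (projClosure X)) = vanishingIdeal ℂ (cone X) := by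
  apply le_antisymm
  · intro f hf v hv
    exact hf v ⟨hv.1, subset_projClosure X hv.2⟩
  · intro f hf v hv
    exact (mem_cone_projClosure_iff.mp hv).2 f hf

theorem projClosure_projClosure (X : Set (P m)) : projClosure (projClosure X) = projClosure X := by
  ext x
  rw [mem_projClosure_iff, vanishingIdeal_cone_projClosure, mem_projClosure_iff]

theorem projClosure_mono {X Y : Set (P m)} (h : X ⊆ Y) : projClosure X ⊆ projClosure Y := by
  intro x hx
  rw [mem_projClosure_iff] at hx ⊢
  exact fun f hf => hx f fun v hv => hf v ⟨hv.1, h hv.2⟩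

theorem tangentSpace_cone_smul (X : Set (P m)) (v : V m) {c : ℂ} (hc : c ≠ 0) :
    tangentSpace (cone X) (c • v) = tangentSpace (cone X) v := by
  have key : ∀ (v : V m) (c : ℂ), c ≠ 0 →
      tangentSpace (cone X) v ≤ tangentSpace (cone X) (c • v) := by
    intro v c hc t ht f hf
    have h1 := mem_tangentSpace.mp ht _ (dilate_mem hf hc)
    rw [grad_dilate, smul_dotProduct, smul_eq_mul] at h1
    exact (mul_eq_zero.mp h1).resolve_left hc
  refine le_antisymm ?_ (key v c hc)
  have := key (c • v) c⁻¹ (inv_ne_zero hc)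
  rwa [smul_smul, inv_mul_cancel₀ hc, one_smul] at this

theorem isSmoothPoint_cone_smul {X : Set (P m)} {v : V m} {c : ℂ} (hc : c ≠ 0) :
    IsSmoothPoint (cone X) (c • v) ↔ IsSmoothPoint (cone X) v := by
  rw [IsSmoothPoint, IsSmoothPoint, tangentSpace_cone_smul X v hc, smul_mem_cone_iff hc]

/-- Euler's relation: a point of a cone is tangent to it at itself. -/
theorem self_mem_tangentSpace_cone {X : Set (P m)} {v : V m} (hv : v ∈ cone X) :
    v ∈ tangentSpace (cone X) v := by
  rw [mem_tangentSpace]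
  intro f hf
  -- As a polynomial in c, f(cv) has every c ≠ 0 as a root, so it is zero; its derivative at c = 1
  -- is the desired relation.
  let x : Fin (m + 1) → Polynomial ℂ := fun i => Polynomial.X * Polynomial.C (v i)
  have hev : ∀ (c : ℂ) (g : MvPolynomial (Fin (m + 1)) ℂ),
      (aeval x g).eval c = aeval (c • v) g := by
    intro c g
    rw [← Polynomial.coe_aeval_eq_eval, comp_aeval_apply]
    congr 2
    ext i
    simp [x]
    ring
  have h0 : aeval x f = 0 := by
    refine Polynomial.eq_zero_of_infinite_isRoot _ ?_
    refine Set.Infinite.mono (s := {e : ℂ | e ≠ 0}) (fun e he => ?_)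
      (Set.finite_singleton (0 : ℂ)).infinite_compl
    rw [Set.mem_ofPred_eq, Polynomial.IsRoot, hev]
    exact hf _ (smul_mem_cone hv he)
  have h1 := Derivation.map_aeval_eq x (Polynomial.derivative' (R := ℂ)) f
  rw [h0, map_zero] at h1
  have h2 := congrArg (Polynomial.eval 1) h1
  simp only [dotProduct, Polynomial.eval_finsetSum, Polynomial.eval_mul, grad, hev] at h2
  simpa [x, dotProduct, grad] using h2.symm

theorem ofAffine_mem_iff {X : Set (P m)} {u : Fin m → ℂ} :
    ofAffine u ∈ X ↔ (Fin.cons 1 u : V m) ∈ cone X :=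
  (mem_cone_mk _).symm

theorem cons_one_smul_mem_cone {X : Set (P m)} {u : Fin m → ℂ} (hu : ofAffine u ∈ X) {c : ℂ}
    (hc : c ≠ 0) : (Fin.cons c fun i => c * u i : V m) ∈ cone X := by
  have := smul_mem_cone (ofAffine_mem_iff.mp hu) hc
  convert this using 1
  ext i
  refine Fin.cases ?_ (fun i => ?_) i <;> simp

theorem mem_cone_ofAffine_image {T : Set (Fin m → ℂ)} {v : V m} :
    v ∈ cone (ofAffine '' T) ↔ ∃ u ∈ T, ∃ c : ℂ, c ≠ 0 ∧ v = c • (Fin.cons 1 u : V m) := by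
  constructor
  · rintro ⟨h, u, hu, he⟩
    obtain ⟨a, ha⟩ := (Projectivization.mk_eq_mk_iff ℂ v (Fin.cons 1 u : V m) h _).mp he.symm
    exact ⟨u, hu, a, a.ne_zero, ha.symm⟩
  · rintro ⟨u, hu, c, hc, rfl⟩
    exact smul_mem_cone (ofAffine_mem_iff.mp (Set.mem_image_of_mem _ hu)) hc

theorem notMem_atInfinity_mk {v : V m} (hv : v ≠ 0) :
    Projectivization.mk ℂ v hv ∉ atInfinity m ↔ v 0 ≠ 0 := by
  obtain ⟨c, hc, hr⟩ := exists_rep_mk_eq hv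
  simp [atInfinity, hr, hc]

/-- A proper closed irreducible subset is cut out by an equation whose gradient is not identically
zero on it. -/
theorem exists_grad_notMem {S : Set (P m)} (hS : IsProjectiveVariety S) (hne : S ≠ Set.univ) :
    ∃ g ∈ vanishingIdeal ℂ (cone S), ∃ i, pderiv i g ∉ vanishingIdeal ℂ (cone S) := by
  by_contra! hcon
  have hI : vanishingIdeal ℂ (cone S) = ⊥ := by
    rw [eq_bot_iff]
    have hC : ∀ a : ℂ, (C a : MvPolynomial (Fin (m + 1)) ℂ) ∈ vanishingIdeal ℂ (cone S) → a = 0 := by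
      intro a ha
      by_contra h
      exact hS.2.ne_top (Ideal.eq_top_of_isUnit_mem _ ha ((isUnit_iff_ne_zero.mpr h).map C))
    -- If the ideal were stable under all partial derivatives, descent on the degree would make the
    -- derivatives of each member zero. The member would be a constant, hence zero since the ideal
    -- is proper.
    have key : ∀ n : ℕ, ∀ g ∈ vanishingIdeal ℂ (cone S), g.totalDegree ≤ n → g = 0 := by
      intro n
      induction n with
      | zero =>
        intro g hg hn
        rw [(totalDegree_eq_zero_iff_eq_C).mp (Nat.le_zero.mp hn)] at hg ⊢
        rw [hC _ hg, C_0]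
      | succ n ih =>
        intro g hg hn
        have h0 : ∀ i, pderiv i g = 0 := by
          refine fun i => ih _ (hcon g hg i) (Finset.sup_le fun t ht => ?_)
          rw [mem_support_iff, coeff_pderiv] at ht
          have h1 := le_totalDegree (mem_support_iff.mpr (left_ne_zero_of_mul ht))
          rw [Finsupp.sum_add_index' (by simp) (by simp), Finsupp.sum_single_index rfl] at h1
          omega
        have h1 : g = C (coeff 0 g) := by
          ext s
          rw [coeff_C]
          split_ifs with hs
          · rw [hs]
          · obtain ⟨i, hi⟩ := Finsupp.ne_iff.mp (Ne.symm hs)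
            have h2 := congrArg (coeff (s - Finsupp.single i 1)) (h0 i)
            rw [coeff_pderiv, tsub_add_cancel_of_le (by
              rw [Finsupp.single_le_iff]; exact Nat.one_le_iff_ne_zero.mpr hi), coeff_zero] at h2
            exact (mul_eq_zero.mp h2).resolve_right (Nat.cast_add_one_ne_zero _)
        rw [h1] at hg ⊢
        rw [hC _ hg, C_0]
    exact fun g hg => key _ g hg le_rfl
  apply hne
  rw [← hS.1]
  ext x
  simp [mem_projClosure_iff, hI]

end Cone


/-! ### The good points of the graph -/

section Vertical

/-- Otherwise the vertical vector (1, 0) is tangent at the generic point and extends to a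
derivation. It kills the base coordinates, hence also the algebraic element y_0, yet takes the value
1 there. -/
theorem exists_pderiv_zero_ne_zero {m : ℕ} {A : Type} [CommRing A] [IsDomain A] [Algebra ℂ A]
    (y : Fin (m + 1) → A)
    (halg : Algebra.IsAlgebraic (Algebra.adjoin ℂ (Set.range fun i : Fin m => y i.succ)) A) :
    ∃ f : MvPolynomial (Fin (m + 1)) ℂ, aeval y f = 0 ∧ aeval y (pderiv 0 f) ≠ 0 := by
  by_contra! hcon
  let F := FractionRing A
  have hinj := IsFractionRing.injective A F
  have hchar : CharZero F := charZero_of_injective_algebraMap (algebraMap ℂ F).injective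
  let x : Fin (m + 1) → F := fun i => algebraMap A F (y i)
  have hx : ∀ f : MvPolynomial (Fin (m + 1)) ℂ, aeval x f = algebraMap A F (aeval y f) := by
    intro f
    rw [← IsScalarTower.coe_toAlgHom' ℂ, comp_aeval_apply]
    rfl
  obtain ⟨D, hD⟩ := exists_derivation_of_tangent (k := ℂ) (K := F) x (Pi.single 0 1) (fun f hf => by
    rw [hx, map_eq_zero_iff _ hinj] at hf
    simp [grad, hx, hcon f hf])
  have hD' : ∀ i, D (x i) = (Pi.single 0 1 : Fin (m + 1) → F) i := hD
  have h0 : ∀ a : Algebra.adjoin ℂ (Set.range fun i : Fin m => y i.succ),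
      D (algebraMap _ F a) = 0 := by
    rintro ⟨a, ha⟩
    change D (algebraMap A F a) = 0
    induction ha using Algebra.adjoin_induction with
    | mem a ha =>
      obtain ⟨j, rfl⟩ := ha
      exact (hD' j.succ).trans (by simp)
    | algebraMap r => rw [← IsScalarTower.algebraMap_apply ℂ A F]; simp
    | add a b _ _ ha hb => rw [map_add, map_add, ha, hb, add_zero]
    | mul a b _ _ ha hb => rw [map_mul, Derivation.leibniz, ha, hb]; simp
  have hfaith : FaithfulSMul (Algebra.adjoin ℂ (Set.range fun i : Fin m => y i.succ)) F :=
    (faithfulSMul_iff_algebraMap_injective _ _).mpr fun _ _ h => Subtype.ext (hinj h)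
  have h1 : D (x 0) = 0 := Derivation.eq_zero_of_isAlgebraic D h0
    ((halg.isAlgebraic (y 0)).algebraMap)
  rw [hD'] at h1
  simp at h1

end Vertical

section Graph

variable {m : ℕ} {S : Set (P m)} {R : Set (Fin (m + 1) → ℂ)}

/-- One direction uses that the graph lies over the base, the other that it dominates the base. So
the coordinate ring of the base embeds in that of the graph. -/
theorem mem_vanishingIdeal_affinePart_iff (hR : IsAlgebraicFunction S R)
    (f : MvPolynomial (Fin m) ℂ) :
    f ∈ vanishingIdeal ℂ (affinePart S) ↔ aeval (fun i : Fin m => coordFun R i.succ) f = 0 := by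
  have h1 : aeval (fun i : Fin m => coordFun R i.succ) f =
      aeval (coordFun R) (rename Fin.succ f) := by rw [aeval_rename]; rfl
  rw [h1, ← RingHom.mem_ker, ker_aeval_coordFun]
  constructor
  · intro hf p hp
    rw [aeval_rename]
    exact hf _ (hR.2.1 p hp)
  · intro hf O hO
    refine hR.2.2.1 hO f ?_
    rintro _ ⟨p, hp, rfl⟩
    have := hf p hp
    rwa [aeval_rename] at this

theorem ker_aeval_tail (hR : IsAlgebraicFunction S R) :
    RingHom.ker (aeval (fun i : Fin m => coordFun R i.succ) :
      MvPolynomial (Fin m) ℂ →ₐ[ℂ] CoordRing R) = vanishingIdeal ℂ (affinePart S) := by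
  ext f
  rw [RingHom.mem_ker, mem_vanishingIdeal_affinePart_iff hR]

theorem isPrime_vanishingIdeal_affinePart (hR : IsAlgebraicFunction S R) :
    (vanishingIdeal ℂ (affinePart S)).IsPrime := by
  have := hR.1.2
  rw [← ker_aeval_tail hR]
  exact RingHom.ker_isPrime _

/-- The value of an algebraic function is algebraic over the coordinates of the base point. -/
theorem isAlgebraic_adjoin_tail (hR : IsAlgebraicFunction S R) :
    Algebra.IsAlgebraic
      (Algebra.adjoin ℂ (Set.range fun i : Fin m => coordFun R i.succ)) (CoordRing R) := by
  have := hR.1.2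
  set A₀ := Algebra.adjoin ℂ (Set.range fun i : Fin m => coordFun R i.succ) with hA₀
  -- A₀ is the coordinate ring of the base. As graph and base have the same finite dimension, the
  -- relative transcendence degree is zero.
  have h1 : Algebra.trdeg ℂ A₀ = Algebra.trdeg ℂ (CoordRing (affinePart S)) := by
    rw [hA₀, Algebra.adjoin_range_eq_range_aeval,
      ← (Ideal.quotientKerEquivRange (aeval (fun i : Fin m => coordFun R i.succ) :
        MvPolynomial (Fin m) ℂ →ₐ[ℂ] CoordRing R)).trdeg_eq]
    exact (Ideal.quotientEquivAlgOfEq ℂ (ker_aeval_tail hR)).trdeg_eq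
  have hf₁ : FaithfulSMul ℂ A₀ :=
    (faithfulSMul_iff_algebraMap_injective _ _).mpr (algebraMap ℂ A₀).injective
  have h2 := trdeg_add_eq ℂ A₀ (A := CoordRing R)
  have h3 : Algebra.trdeg ℂ (CoordRing R) = Algebra.trdeg ℂ A₀ := by
    rw [h1]; exact hR.2.2.2
  have h4 : Algebra.trdeg ℂ (CoordRing R) < Cardinal.aleph0 := trdeg_lt_aleph0_of_finiteType
  rw [← trdeg_eq_zero_iff]
  rw [h3] at h2 h4
  refine Cardinal.eq_of_add_eq_add_left (a := Algebra.trdeg ℂ A₀) ?_ h4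
  rw [h2, add_zero]

theorem exists_pderiv_zero_notMem (hR : IsAlgebraicFunction S R) :
    ∃ f ∈ vanishingIdeal ℂ R, pderiv 0 f ∉ vanishingIdeal ℂ R := by
  have := hR.1.2
  obtain ⟨f, hf, hf0⟩ := exists_pderiv_zero_ne_zero (coordFun R) (isAlgebraic_adjoin_tail hR)
  rw [← ker_aeval_coordFun]
  exact ⟨f, hf, hf0⟩

/-- Each of the three requirements is open: H is the product of a smoothness equation of the graph,
one of the base, and a derivative ∂f/∂r whose nonvanishing excludes vertical tangent vectors. -/
theorem exists_graphGood (hR : IsAlgebraicFunction S R) :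
    ∃ H : MvPolynomial (Fin (m + 1)) ℂ, H ∉ vanishingIdeal ℂ R ∧
      ∀ p ∈ R, aeval p H ≠ 0 → p ∈ graphGood S R := by
  have hp := hR.1.2
  have hp' := isPrime_vanishingIdeal_affinePart hR
  obtain ⟨H₁, h₁, hs₁⟩ := exists_smooth_of_isPrime R
  obtain ⟨H₂, h₂, hs₂⟩ := exists_smooth_of_isPrime (affinePart S)
  obtain ⟨f, hf, hf0⟩ := exists_pderiv_zero_notMem hR
  refine ⟨H₁ * rename Fin.succ H₂ * pderiv 0 f, ?_, fun p hpR hH => ?_⟩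
  · refine hp.mul_notMem (hp.mul_notMem h₁ fun h => h₂ ?_) hf0
    rw [mem_vanishingIdeal_affinePart_iff hR]
    rw [← ker_aeval_coordFun, RingHom.mem_ker, aeval_rename] at h
    exact h
  · rw [map_mul, map_mul, aeval_rename] at hH
    refine ⟨hs₁ p hpR (left_ne_zero_of_mul (left_ne_zero_of_mul hH)),
      hs₂ _ (hR.2.1 p hpR) (right_ne_zero_of_mul (left_ne_zero_of_mul hH)), fun t ht h0 => ?_⟩
    have h1 := mem_tangentSpace.mp ht f hf
    simp only [dotProduct, Fin.sum_univ_succ, show ∀ i : Fin m, t i.succ = 0 from congrFun h0,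
      mul_zero, Finset.sum_const_zero, add_zero] at h1
    have h2 : t 0 = 0 := (mul_eq_zero.mp h1).resolve_left (right_ne_zero_of_mul hH)
    ext i
    refine Fin.cases h2 (fun i => congrFun h0 i) i

end Graph

/-! ### Points of the incidence variety -/

section Incidence

variable {m : ℕ} {S : Set (P m)} {R : Set (Fin (m + 1) → ℂ)}
  {B : LinearMap.BilinForm ℂ (Fin m → ℂ)}

theorem tail_mem_tangentSpace (hR : IsAlgebraicFunction S R) {p t : Fin (m + 1) → ℂ}
    (ht : t ∈ tangentSpace R p) :
    (Fin.tail t : Fin m → ℂ) ∈ tangentSpace (affinePart S) (Fin.tail p) := by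
  rw [mem_tangentSpace] at ht ⊢
  intro f hf
  rw [mem_vanishingIdeal_affinePart_iff hR] at hf
  have h1 := ht (rename Fin.succ f) (by
    rw [← ker_aeval_coordFun, RingHom.mem_ker, aeval_rename]; exact hf)
  have h4 : ∀ i : Fin m, pderiv i.succ (rename Fin.succ f) = rename Fin.succ (pderiv i f) :=
    fun i => pderiv_rename (Fin.succ_injective m) i f
  have h5 : pderiv 0 (rename Fin.succ f : MvPolynomial (Fin (m + 1)) ℂ) = 0 := by
    classical
    refine pderiv_eq_zero_of_notMem_vars fun h => ?_
    obtain ⟨i, _, hi⟩ := Finset.mem_image.mp (vars_rename Fin.succ f h)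
    exact Fin.succ_ne_zero i hi
  simp only [dotProduct, Fin.sum_univ_succ, grad, h4, h5, map_zero, zero_mul, zero_add,
    aeval_rename] at h1
  exact h1

/-- The projection of tangent spaces is injective, as there is no vertical vector, and both points
are smooth on varieties of equal dimension. -/
theorem exists_tangent_lift (hR : IsAlgebraicFunction S R) {p : Fin (m + 1) → ℂ}
    (hp : p ∈ graphGood S R) {η : Fin m → ℂ}
    (hη : η ∈ tangentSpace (affinePart S) (Fin.tail p)) :
    ∃ t ∈ tangentSpace R p, (Fin.tail t : Fin m → ℂ) = η := by
  let φ : tangentSpace R p →ₗ[ℂ] tangentSpace (affinePart S) (Fin.tail p) :=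
    ((LinearMap.funLeft ℂ ℂ (Fin.succ : Fin m → Fin (m + 1))) ∘ₗ (tangentSpace R p).subtype).codRestrict
      _ fun t => tail_mem_tangentSpace hR t.2
  have hinj : Function.Injective φ := by
    rw [injective_iff_map_eq_zero]
    intro t ht
    exact Subtype.ext (hp.2.2 t t.2 (congrArg Subtype.val ht))
  have hrank : Module.finrank ℂ (tangentSpace R p) =
      Module.finrank ℂ (tangentSpace (affinePart S) (Fin.tail p)) := by
    rw [Module.finrank, Module.finrank, hp.1.2, hp.2.1.2, hR.2.2.2]
  obtain ⟨t, ht⟩ := ((LinearMap.injective_iff_surjective_of_finrank_eq_finrank hrank).mp hinj)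
    ⟨η, hη⟩
  exact ⟨t, t.2, congrArg Subtype.val ht⟩

/-- Over the good points of the graph, the affine spaces are contained in the spheres. -/
theorem mem_spheres_of_mem_affineSpaces (hBsymm : B.IsSymm) (hBnondeg : B.Nondegenerate)
    (hR : IsAlgebraicFunction S R)
    (h1 : ∀ O : Fin m → ℂ, IsSmoothPoint (affinePart S) O →
      HasTotallyIsotropicAnnihilator B (tangentSpace (affinePart S) O))
    (h21 : ∀ p ∈ graphGood S R, ∃ ξ : Fin m → ℂ, MapsToDifferential B S R p ξ)
    (h22 : ∀ p ∈ graphGood S R, ∀ ξ : Fin m → ℂ, MapsToDifferential B S R p ξ →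
      (1 / 4) * B ξ ξ = p 0) {x : Fin m → ℂ} {p : Fin (m + 1) → ℂ} (hp : p ∈ graphGood S R)
    (hx : (x, p) ∈ affineSpaces B R) : (x, p) ∈ spheres B := by
  set T := tangentSpace (affinePart S) (Fin.tail p)
  have hrefl : B.IsRefl := hBsymm.isRefl
  have haff : ∀ t ∈ tangentSpace R p,
      B (x - Fin.tail p) (Fin.tail t) + (1 / 2) * t 0 = 0 := hx
  obtain ⟨ξ, hξ, hξt⟩ := h21 p hp
  -- A totally isotropic T^⊥ lies in (T^⊥)^⊥ = T.
  have hT : B.orthogonal T ≤ T := by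
    intro u hu
    rw [← LinearMap.BilinForm.orthogonal_orthogonal hBnondeg hrefl T]
    intro v hv
    exact h1 _ hp.2.1 v hv u hu
  -- With the factor -2 the affine condition says exactly that ξ' represents dr, and ¼⟨ξ', ξ'⟩
  -- becomes ⟨x - O, x - O⟩.
  set ξ' := (-2 : ℂ) • (x - Fin.tail p) with hξ'
  have hd : ∀ t ∈ tangentSpace R p, B ξ' (Fin.tail t) = t 0 := by
    intro t ht
    rw [hξ', map_smul, LinearMap.smul_apply, smul_eq_mul]
    linear_combination (-2) * haff t ht
  -- Both vectors represent dr on T. As T^⊥ ⊆ T and ξ is tangent, ξ' is tangent too, which is what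
  -- 2.2) requires.
  have hmem : ξ' - ξ ∈ B.orthogonal T := by
    intro η hη
    obtain ⟨t, ht, rfl⟩ := exists_tangent_lift hR hp hη
    apply hrefl
    change B (ξ' - ξ) (Fin.tail t) = 0
    rw [map_sub, LinearMap.sub_apply, hd t ht, hξt t ht, sub_self]
  have h3 := h22 p hp ξ' ⟨by simpa using T.add_mem (hT hmem) hξ, hd⟩
  change B (x - Fin.tail p) (x - Fin.tail p) = p 0
  rw [← h3, hξ']
  simp only [map_smul, LinearMap.smul_apply, smul_eq_mul]
  ring

end Incidence


/-! ### Parametrization of the inverse focal construction -/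

section Parametrization

variable {m : ℕ}

theorem exists_gramMatrix {B : LinearMap.BilinForm ℂ (Fin m → ℂ)} (hBsymm : B.IsSymm)
    (hBnondeg : B.Nondegenerate) :
    ∃ M : Matrix (Fin m) (Fin m) ℂ, M.IsSymm ∧ IsUnit M.det ∧
      ∀ u v, B u v = M.mulVec u ⬝ᵥ v := by
  refine ⟨LinearMap.BilinForm.toMatrix' B, ?_, ?_, fun u v => ?_⟩
  · ext i j
    simp [LinearMap.BilinForm.toMatrix'_apply, hBsymm.eq]
  · rw [isUnit_iff_ne_zero]
    exact Matrix.nondegenerate_iff_det_ne_zero.mp hBnondeg.toMatrix'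
  · rw [← hBsymm.eq v u, dotProduct_comm, ← Matrix.toBilin'_apply', Matrix.toBilin'_toMatrix']

/-- The point of the cone over `X` attached to a conormal vector `w` of the graph at `p`. -/
noncomputable def spherePoint {E : Type} [CommRing E] [Algebra ℂ E] (G : Matrix (Fin m) (Fin m) ℂ)
    (p w : Fin (m + 1) → E) : Fin (m + 1) → E :=
  Fin.cons (2 * w 0) fun i =>
    2 * w 0 * p i.succ + (G.map (algebraMap ℂ E)).mulVec (fun i => w i.succ) i

@[simp] theorem spherePoint_zero {E : Type} [CommRing E] [Algebra ℂ E]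
    (G : Matrix (Fin m) (Fin m) ℂ) (p w : Fin (m + 1) → E) : spherePoint G p w 0 = 2 * w 0 := rfl

@[simp] theorem spherePoint_succ {E : Type} [CommRing E] [Algebra ℂ E]
    (G : Matrix (Fin m) (Fin m) ℂ) (p w : Fin (m + 1) → E) (i : Fin m) :
    spherePoint G p w i.succ =
      2 * w 0 * p i.succ + (G.map (algebraMap ℂ E)).mulVec (fun i => w i.succ) i := rfl

theorem map_mulVec_apply {E E' : Type} [CommRing E] [CommRing E'] [Algebra ℂ E] [Algebra ℂ E']
    (φ : E →ₐ[ℂ] E') (G : Matrix (Fin m) (Fin m) ℂ) (v : Fin m → E) (i : Fin m) :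
    φ ((G.map (algebraMap ℂ E)).mulVec v i) =
      (G.map (algebraMap ℂ E')).mulVec (fun i => φ (v i)) i := by
  simp [Matrix.mulVec, dotProduct, map_sum]

theorem map_spherePoint {E E' : Type} [CommRing E] [CommRing E'] [Algebra ℂ E] [Algebra ℂ E']
    (φ : E →ₐ[ℂ] E') (G : Matrix (Fin m) (Fin m) ℂ) (p w : Fin (m + 1) → E) (i : Fin (m + 1)) :
    φ (spherePoint G p w i) = spherePoint G (fun i => φ (p i)) (fun i => φ (w i)) i := by
  refine Fin.cases ?_ (fun i => ?_) i
  · simp only [spherePoint_zero, map_mul, map_ofNat]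
  · simp only [spherePoint_succ, map_add, map_mul, map_ofNat, map_mulVec_apply]

/-- At a point with coordinates in the field of coefficients the gradients already form a subspace,
because an ideal is stable under scalars. -/
theorem mem_conormal_iff_exists_grad {ι : Type} [Fintype ι] (I : Ideal (MvPolynomial ι ℂ))
    (p q : ι → ℂ) : q ∈ conormal I p ↔ ∃ f ∈ I, grad p f = q := by
  refine ⟨fun h => ?_, fun ⟨f, hf, h⟩ => Submodule.subset_span ⟨f, hf, h⟩⟩
  rw [conormal] at h
  induction h using Submodule.span_induction with
  | mem q hq => exact hq
  | zero => exact ⟨0, I.zero_mem, by ext; simp [grad]⟩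
  | add a b _ _ ha hb =>
    obtain ⟨f, hf, rfl⟩ := ha
    obtain ⟨g, hg, rfl⟩ := hb
    exact ⟨f + g, I.add_mem hf hg, grad_add _ _ _⟩
  | smul c a _ ha =>
    obtain ⟨f, hf, rfl⟩ := ha
    exact ⟨C c * f, I.mul_mem_left _ hf, grad_C_mul _ _ _⟩

section Pointwise

variable {S : Set (P m)} {R : Set (Fin (m + 1) → ℂ)} {B : LinearMap.BilinForm ℂ (Fin m → ℂ)}
  {M : Matrix (Fin m) (Fin m) ℂ}

/-- By double annihilation, a covector killing the tangent space of the graph is the gradient of an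
equation. This turns points x into conormal vectors. -/
theorem mem_affineSpaces_iff (hB : ∀ u v, B u v = M.mulVec u ⬝ᵥ v) {x : Fin m → ℂ}
    {p : Fin (m + 1) → ℂ} :
    (x, p) ∈ affineSpaces B R ↔ ∃ f ∈ vanishingIdeal ℂ R,
      grad p f = Fin.cons (1 / 2) (M.mulVec (x - Fin.tail p)) := by
  rw [← mem_conormal_iff_exists_grad]
  have key : ∀ t : Fin (m + 1) → ℂ,
      B (x - Fin.tail p) (Fin.tail t) + (1 / 2) * t 0 =
        (Fin.cons (1 / 2) (M.mulVec (x - Fin.tail p)) : Fin (m + 1) → ℂ) ⬝ᵥ t := by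
    intro t
    rw [hB, dotProduct, dotProduct, Fin.sum_univ_succ, add_comm]
    rfl
  constructor
  · intro h
    refine mem_of_dotProduct_annihilated fun t ht => ?_
    rw [← key]
    rw [← tangentSpace_eq_annihilated] at ht
    exact h t ht
  · intro h t ht
    rw [key]
    rw [tangentSpace_eq_annihilated] at ht
    exact mem_annihilated.mp ht _ h

theorem exists_spherePoint_of_mem_affineSpaces (hdet : IsUnit M.det)
    (hB : ∀ u v, B u v = M.mulVec u ⬝ᵥ v) {x : Fin m → ℂ}
    {p : Fin (m + 1) → ℂ} (h : (x, p) ∈ affineSpaces B R) :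
    ∃ f ∈ vanishingIdeal ℂ R, spherePoint M⁻¹ p (grad p f) = Fin.cons 1 x := by
  obtain ⟨f, hf, hg⟩ := (mem_affineSpaces_iff hB).mp h
  refine ⟨f, hf, ?_⟩
  rw [hg]
  ext i
  refine Fin.cases ?_ (fun i => ?_) i
  · simp
  · simp [Matrix.mulVec_mulVec, Matrix.nonsing_inv_mul _ hdet, Fin.tail]

theorem mem_affineSpaces_of_grad (hdet : IsUnit M.det) (hB : ∀ u v, B u v = M.mulVec u ⬝ᵥ v)
    {p : Fin (m + 1) → ℂ} {f : MvPolynomial (Fin (m + 1)) ℂ} (hf : f ∈ vanishingIdeal ℂ R)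
    (h0 : grad p f 0 ≠ 0) :
    ((Fin.tail p : Fin m → ℂ) +
      (2 * grad p f 0)⁻¹ • M⁻¹.mulVec (fun i => grad p f i.succ), p) ∈ affineSpaces B R := by
  refine (mem_affineSpaces_iff hB).mpr ⟨C (2 * grad p f 0)⁻¹ * f, Ideal.mul_mem_left _ _ hf, ?_⟩
  rw [grad_C_mul, add_sub_cancel_left, Matrix.mulVec_smul, Matrix.mulVec_mulVec,
    Matrix.mul_nonsing_inv _ hdet, Matrix.one_mulVec]
  ext i
  refine Fin.cases ?_ (fun i => ?_) i
  · simp; field_simp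
  · simp

theorem spherePoint_eq_smul {G : Matrix (Fin m) (Fin m) ℂ} {p w : Fin (m + 1) → ℂ} (h0 : w 0 ≠ 0) :
    spherePoint G p w = (2 * w 0) • (Fin.cons 1 ((Fin.tail p : Fin m → ℂ) +
      (2 * w 0)⁻¹ • G.mulVec fun i => w i.succ) : Fin (m + 1) → ℂ) := by
  ext i
  refine Fin.cases ?_ (fun i => ?_) i
  · simp
  · simp [Fin.tail]
    field_simp

end Pointwise

/-! ### Specialization of the parameters: a point of the graph and coefficients -/

section Evaluation

variable {ι : Type} {R : Set (ι → ℂ)} {d : ℕ}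

/-- Evaluation of a polynomial with coefficients in the ring of polynomial functions. -/
noncomputable def evalAt₂ {p : ι → ℂ} (hp : p ∈ R) (c : Fin d → ℂ) :
    MvPolynomial (Fin d) (CoordRing R) →ₐ[ℂ] ℂ :=
  (aeval c : MvPolynomial (Fin d) ℂ →ₐ[ℂ] ℂ).comp (mapAlgHom (evalAt hp))

@[simp] theorem evalAt₂_C {p : ι → ℂ} (hp : p ∈ R) (c : Fin d → ℂ) (a : CoordRing R) :
    evalAt₂ hp c (C a) = evalAt hp a := by
  simp [evalAt₂]

@[simp] theorem evalAt₂_X {p : ι → ℂ} (hp : p ∈ R) (c : Fin d → ℂ) (j : Fin d) :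
    evalAt₂ hp c (X j) = c j := by
  simp [evalAt₂]

/-- Some coefficient of g is nonzero at some point of R; the resulting nonzero polynomial over the
infinite field ℂ has a nonzero value. -/
theorem exists_evalAt₂_ne_zero {g : MvPolynomial (Fin d) (CoordRing R)} (hg : g ≠ 0) :
    ∃ (p : ι → ℂ) (hp : p ∈ R) (c : Fin d → ℂ), evalAt₂ hp c g ≠ 0 := by
  obtain ⟨s, hs⟩ := ne_zero_iff.mp hg
  obtain ⟨f, hf⟩ := Ideal.Quotient.mk_surjective (coeff s g)
  have hfR : f ∉ vanishingIdeal ℂ R := fun h => hs (by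
    rw [← hf, Ideal.Quotient.eq_zero_iff_mem]; exact h)
  obtain ⟨p, hp, hpf⟩ : ∃ p ∈ R, aeval p f ≠ 0 := by
    by_contra! hcon
    exact hfR hcon
  have h1 : mapAlgHom (σ := Fin d) (evalAt hp) g ≠ 0 := by
    refine ne_zero_iff.mpr ⟨s, ?_⟩
    rw [mapAlgHom_apply, coeff_map, ← hf]
    exact hpf
  by_contra! hcon
  exact h1 (MvPolynomial.funext fun c => by
    have := hcon p hp c
    rw [evalAt₂, AlgHom.comp_apply] at this
    simpa using this)

end Evaluation

end Parametrization


/-! ### The normal space at the generic point of the inverse focal construction -/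

section GenericPoint

theorem isAlgebraic_adjoin_generators {k K ι : Type} [Field k] [Field K] [Algebra k K] (z : ι → K)
    (x : ι → IntermediateField.adjoin k (Set.range z)) (hx : ∀ i, (x i : K) = z i) :
    Algebra.IsAlgebraic (Algebra.adjoin k (Set.range x))
      (IntermediateField.adjoin k (Set.range z)) := by
  rw [← IntermediateField.isAlgebraic_adjoin_iff_top]
  have htop : IntermediateField.adjoin k (Set.range x) = ⊤ := by
    apply IntermediateField.lift_injective
    rw [IntermediateField.lift_adjoin, IntermediateField.lift_top, ← Set.range_comp]
    congr 2
    ext1 i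
    exact hx i
  rw [htop]
  exact ⟨fun a => isAlgebraic_algebraMap (⟨a, trivial⟩ : (⊤ : IntermediateField k _))⟩

variable {m d : ℕ} {A : Type} [CommRing A] [Algebra ℂ A]

/-- The generic combination of the gradients of `f`. -/
noncomputable def genericGrad (y : Fin (m + 1) → A) (f : Fin d → MvPolynomial (Fin (m + 1)) ℂ) :
    Fin (m + 1) → MvPolynomial (Fin d) A :=
  fun i => ∑ j, X j * C (grad y (f j) i)

/-- The generic point of the cone over the inverse focal construction. -/
noncomputable def genericPoint (G : Matrix (Fin m) (Fin m) ℂ) (y : Fin (m + 1) → A)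
    (f : Fin d → MvPolynomial (Fin (m + 1)) ℂ) : Fin (m + 1) → MvPolynomial (Fin d) A :=
  spherePoint G (fun i => C (y i)) (genericGrad y f)

/-- Differentiating the equations f_j(y) = 0 shows that a derivation moves the graph point along a
tangent vector, which the conormal vector W annihilates. -/
theorem derivation_genericGrad [IsDomain A] {K : Type} [Field K] [Algebra ℂ K]
    (ψ : MvPolynomial (Fin d) A →ₐ[ℂ] K) (y : Fin (m + 1) → A)
    (f : Fin d → MvPolynomial (Fin (m + 1)) ℂ) (hf : ∀ j, aeval y (f j) = 0)
    (D : Derivation ℂ K K) :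
    ((fun i => ψ (genericGrad y f i)) ⬝ᵥ fun i => D (ψ (C (y i)))) = 0 := by
  let ρ : A →ₐ[ℂ] K := ψ.comp (IsScalarTower.toAlgHom ℂ A (MvPolynomial (Fin d) A))
  have h1 : ∀ j, (fun i => ρ (grad y (f j) i)) ⬝ᵥ (fun i => D (ρ (y i))) = 0 := by
    intro j
    rw [← grad_map y ρ (f j), ← Derivation.map_aeval_eq, ← comp_aeval_apply, hf, map_zero, map_zero]
  have h2 : (fun i => ψ (genericGrad y f i)) =
      ∑ j, ψ (X j) • fun i => ρ (grad y (f j) i) := by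
    ext i
    simp only [genericGrad, map_sum, map_mul, Finset.sum_apply, Pi.smul_apply, smul_eq_mul]
    rfl
  rw [h2, sum_dotProduct]
  refine Finset.sum_eq_zero fun j _ => ?_
  rw [smul_dotProduct]
  exact (congrArg _ (h1 j)).trans (smul_zero _)

/-- Independence of the frame gives a left inverse with denominators, so the indeterminate
coefficients are rational in W and the graph point. -/
theorem X_mem_of_genericGrad_mem [IsDomain A] {K : Type} [Field K] [Algebra ℂ K]
    (ψ : MvPolynomial (Fin d) A →ₐ[ℂ] K) (hψ : Function.Injective ψ) (y : Fin (m + 1) → A)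
    (f : Fin d → MvPolynomial (Fin (m + 1)) ℂ)
    (hli : LinearIndependent (FractionRing A)
      (fun j i => algebraMap A (FractionRing A) (grad y (f j) i)))
    (E : Subfield K) (hA : ∀ a : A, ψ (C a) ∈ E) (hW : ∀ i, ψ (genericGrad y f i) ∈ E) (l : Fin d) :
    ψ (X l) ∈ E := by
  obtain ⟨r, hr, n, hn⟩ := exists_leftInverse_of_linearIndependent _ hli
  have h1 : C r * X l = ∑ i, C (n l i) * genericGrad y f i := by
    simp only [genericGrad, Finset.mul_sum]
    rw [Finset.sum_comm]
    have h2 : ∀ j, ∑ i, C (n l i) * (X j * C (grad y (f j) i)) =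
        (X j * C (if l = j then r else 0) : MvPolynomial (Fin d) A) := by
      intro j
      rw [← hn, map_sum, Finset.mul_sum]
      refine Finset.sum_congr rfl fun i _ => ?_
      rw [C_mul]; ring
    rw [Finset.sum_congr rfl fun j _ => h2 j]
    simp [apply_ite C, mul_comm]
  have h2 : ψ (C r) ≠ 0 := by
    rw [map_ne_zero_iff _ hψ]
    exact (C_ne_zero).mpr hr
  have h3 : ψ (X l) = (∑ i, ψ (C (n l i)) * ψ (genericGrad y f i)) / ψ (C r) := by
    rw [eq_div_iff h2, mul_comm, ← map_mul, h1, map_sum]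
    simp
  rw [h3]
  exact div_mem (sum_mem fun i _ => mul_mem (hA _) (hW i)) (hA r)

theorem trdeg_fractionRing_mvPolynomial [IsDomain A] {n : ℕ} (hn : Algebra.trdeg ℂ A = n) :
    Algebra.trdeg ℂ (FractionRing (MvPolynomial (Fin d) A)) = ((n + d : ℕ) : Cardinal) := by
  have hf : FaithfulSMul ℂ A :=
    (faithfulSMul_iff_algebraMap_injective _ _).mpr (algebraMap ℂ A).injective
  have hf' : FaithfulSMul ℂ (MvPolynomial (Fin d) A) :=
    (faithfulSMul_iff_algebraMap_injective _ _).mpr (algebraMap ℂ (MvPolynomial (Fin d) A)).injective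
  have h1 := trdeg_add_eq ℂ A (A := MvPolynomial (Fin d) A)
  have h2 := trdeg_add_eq ℂ (MvPolynomial (Fin d) A) (A := FractionRing (MvPolynomial (Fin d) A))
  have halg : Algebra.IsAlgebraic (MvPolynomial (Fin d) A)
      (FractionRing (MvPolynomial (Fin d) A)) :=
    IsLocalization.isAlgebraic _ (nonZeroDivisors _)
  rw [trdeg_eq_zero (R := MvPolynomial (Fin d) A), add_zero] at h2
  rw [← h2, ← h1, hn, MvPolynomial.trdeg_of_isDomain]
  simp

/-- At the generic point, the covector `M (x - O)` is a combination of gradients, and the normal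
space lies in the closure of the base points `O`. -/
theorem exists_generic_normal [IsDomain A] (y : Fin (m + 1) → A)
    (hy : Algebra.adjoin ℂ (Set.range y) = ⊤)
    (M : Matrix (Fin m) (Fin m) ℂ) (hM : M.IsSymm) (hdet : IsUnit M.det)
    (f : Fin d → MvPolynomial (Fin (m + 1)) ℂ) (hf : ∀ j, aeval y (f j) = 0)
    (hli : LinearIndependent (FractionRing A)
      (fun j i => algebraMap A (FractionRing A) (grad y (f j) i)))
    {n : ℕ} (hn : Algebra.trdeg ℂ A = n) (hnd : n + d = m + 1)
    (hW : genericGrad y f 0 ≠ 0)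
    (hsph : (fun i : Fin m => genericGrad y f i.succ) ⬝ᵥ
      (M⁻¹.map (algebraMap ℂ (MvPolynomial (Fin d) A))).mulVec (fun i => genericGrad y f i.succ) =
        4 * genericGrad y f 0 ^ 2 * C (y 0)) :
    (∃ (s : ℕ) (F : Fin s → MvPolynomial (Fin (m + 1)) ℂ) (r : MvPolynomial (Fin d) A)
      (b : Fin s → MvPolynomial (Fin d) A), r ≠ 0 ∧ (∀ j, aeval (genericPoint M⁻¹ y f) (F j) = 0) ∧
      ∀ i : Fin m, r * genericGrad y f i.succ =
        ∑ j, b j * grad (genericPoint M⁻¹ y f) (F j) i.succ) ∧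
    ∀ g : MvPolynomial (Fin (m + 1)) ℂ,
      aeval (Fin.cons Polynomial.X (fun i => Polynomial.X * Polynomial.C (y i.succ)) :
        Fin (m + 1) → Polynomial A) g = 0 →
      ∀ (e : ℂ) (F : MvPolynomial (Fin (m + 1)) ℂ), aeval (genericPoint M⁻¹ y f) F = 0 →
        aeval (Fin.cons (algebraMap ℂ _ e * genericPoint M⁻¹ y f 0) fun i =>
          algebraMap ℂ _ e * genericPoint M⁻¹ y f i.succ +
            (M⁻¹.map (algebraMap ℂ (MvPolynomial (Fin d) A))).mulVec
              (fun i => grad (genericPoint M⁻¹ y f) F i.succ) i :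
          Fin (m + 1) → MvPolynomial (Fin d) A) g = 0 := by
  classical
  set Φ := genericPoint M⁻¹ y f with hΦ
  set W := genericGrad y f with hWdef
  let Q := MvPolynomial (Fin d) A
  let K := FractionRing Q
  let ψ : Q →ₐ[ℂ] K := IsScalarTower.toAlgHom ℂ Q K
  have hψ : Function.Injective ψ := IsFractionRing.injective Q K
  have hchar : CharZero K := charZero_of_injective_algebraMap (algebraMap ℂ K).injective
  have hψG : ∀ (v : Fin m → Q) (i : Fin m),
      ψ ((M⁻¹.map (algebraMap ℂ (MvPolynomial (Fin d) A))).mulVec v i) =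
        (M⁻¹.map (algebraMap ℂ K)).mulVec (fun i => ψ (v i)) i :=
    fun v i => map_mulVec_apply ψ _ v i
  let z : Fin (m + 1) → K := fun i => ψ (Φ i)
  let L := IntermediateField.adjoin ℂ (Set.range z)
  let x : Fin (m + 1) → L := fun i => ⟨z i, IntermediateField.subset_adjoin ℂ _ ⟨i, rfl⟩⟩
  have hxz : ∀ i, algebraMap L K (x i) = ψ (Φ i) := fun i => rfl
  let p : Fin (m + 1) → K := fun i => ψ (C (y i))
  let w : Fin m → K := fun i => ψ (W i.succ)
  let u : Fin m → K := fun i => algebraMap L K (x i.succ) - algebraMap L K (x 0) * p i.succ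
  have hΦ0 : Φ 0 = 2 * W 0 := rfl
  have hz0 : z 0 = 2 * ψ (W 0) := by
    change ψ (Φ 0) = _
    rw [hΦ0, map_mul, map_ofNat]
  have hx0 : x 0 ≠ 0 := by
    intro h
    have h1 : z 0 = 0 := congrArg Subtype.val h
    rw [hz0, mul_eq_zero, map_eq_zero_iff _ hψ] at h1
    exact h1.elim two_ne_zero hW
  have hu : u = (M⁻¹.map (algebraMap ℂ K)).mulVec w := by
    ext i
    have h1 : Φ i.succ = Φ 0 * C (y i.succ) +
      (M⁻¹.map (algebraMap ℂ Q)).mulVec (fun i => W i.succ) i := rfl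
    change ψ (Φ i.succ) - ψ (Φ 0) * ψ (C (y i.succ)) = _
    rw [h1, map_add, map_mul, add_sub_cancel_left, map_mulVec_apply]
  have hw : w = (M.map (algebraMap ℂ K)).mulVec u := by
    rw [hu, Matrix.mulVec_mulVec, ← Matrix.map_mul, Matrix.mul_nonsing_inv _ hdet]
    simp
  have hcoef : ∀ a : A, ∀ E : IntermediateField L K, (∀ i, p i ∈ E) → ψ (C a) ∈ E := by
    intro a E hE
    have ha : a ∈ Algebra.adjoin ℂ (Set.range y) := hy ▸ Algebra.mem_top
    induction ha using Algebra.adjoin_induction with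
    | mem a ha => obtain ⟨i, rfl⟩ := ha; exact hE i
    | algebraMap r =>
      have : ψ (C (algebraMap ℂ A r)) = algebraMap L K (algebraMap ℂ L r) := by
        rw [← IsScalarTower.algebraMap_apply ℂ L K, ← ψ.commutes]; rfl
      rw [this]
      exact E.algebraMap_mem _
    | add a b _ _ ha hb => rw [C_add, map_add]; exact add_mem ha hb
    | mul a b _ _ ha hb => rw [C_mul, map_mul]; exact mul_mem ha hb
  -- The point x of X together with the graph point determines W, and W determines the parameters.
  -- So K is generated over L by the coordinates of the graph point.
  have hgen : ∀ E : IntermediateField L K, (∀ i, p i ∈ E) → ∀ a : K, a ∈ E := by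
    intro E hE
    have hC : ∀ c : ℂ, algebraMap ℂ K c ∈ E := fun c => by
      rw [IsScalarTower.algebraMap_apply ℂ L K]; exact E.algebraMap_mem _
    have huE : ∀ i, u i ∈ E := fun i =>
      sub_mem (E.algebraMap_mem _) (mul_mem (E.algebraMap_mem _) (hE _))
    have hWE : ∀ i, ψ (W i) ∈ E := by
      refine Fin.cases ?_ fun i => ?_
      · have h2 : ψ (W 0) = algebraMap L K (x 0) / 2 := by
          rw [hxz, hΦ0, map_mul, map_ofNat, mul_div_cancel_left₀ _ two_ne_zero]
        rw [h2]
        exact div_mem (E.algebraMap_mem _) (ofNat_mem E 2)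
      · change w i ∈ E
        rw [hw, Matrix.mulVec, dotProduct]
        exact sum_mem fun j _ => mul_mem (hC _) (huE j)
    have hX : ∀ l, ψ (X l) ∈ E := X_mem_of_genericGrad_mem ψ hψ y f hli E.toSubfield
      (fun a => hcoef a E hE) hWE
    have hQ : ∀ q : Q, ψ q ∈ E := by
      intro q
      induction q using MvPolynomial.induction_on with
      | C a => exact hcoef a E hE
      | add a b ha hb => rw [map_add]; exact add_mem ha hb
      | mul_X a i ha => rw [map_mul]; exact mul_mem ha (hX i)
    intro a
    obtain ⟨b, c, _, rfl⟩ := IsFractionRing.div_surjective (A := Q) a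
    exact div_mem (hQ b) (hQ c)
  have hLalg : Algebra.IsAlgebraic (Algebra.adjoin ℂ (Set.range x)) L :=
    isAlgebraic_adjoin_generators z x fun i => rfl
  have hdot : w ⬝ᵥ u = algebraMap L K (x 0) ^ 2 * p 0 := by
    have h1 := congrArg ψ hsph
    rw [hu, hxz, hΦ0]
    simp only [map_mul, map_pow, map_ofNat, dotProduct, map_sum, hψG] at h1 ⊢
    rw [mul_pow]
    refine h1.trans ?_
    norm_num [p]
  -- This is twice W · D(r, O) = 0, with x_0 = 2W_0.
  have hder : ∀ D : Derivation ℂ K K,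
      2 * (w ⬝ᵥ fun i => D (p i.succ)) = - algebraMap L K (x 0) * D (p 0) := by
    intro D
    have h1 := derivation_genericGrad ψ y f hf D
    rw [dotProduct, Fin.sum_univ_succ] at h1
    rw [hxz, hΦ0, map_mul, map_ofNat]
    change 2 * (∑ i : Fin m, ψ (W i.succ) * D (ψ (C (y i.succ)))) = _
    linear_combination 2 * h1
  obtain ⟨c, q, a, ha, hq, haq⟩ := exists_algebraicIndependent_conormal x p M hM hdet hx0 u w rfl hw
    hdot hder (by rw [trdeg_fractionRing_mvPolynomial hn, hnd])
    (fun E hE => ⟨fun a => isAlgebraic_algebraMap (⟨a, hgen E hE a⟩ : E)⟩)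
  have hxval : ∀ F : MvPolynomial (Fin (m + 1)) ℂ,
      algebraMap L K (aeval x F) = ψ (aeval Φ F) := by
    intro F
    rw [comp_aeval_apply, ← IsScalarTower.coe_toAlgHom' ℂ L K, comp_aeval_apply]
    rfl
  have hxker : ∀ F : MvPolynomial (Fin (m + 1)) ℂ, aeval x F = 0 ↔ aeval Φ F = 0 := by
    intro F
    rw [← map_eq_zero_iff _ hψ, ← hxval, map_eq_zero_iff _ (algebraMap L K).injective]
  have hgrad : ∀ F : MvPolynomial (Fin (m + 1)) ℂ, ∀ i,
      algebraMap L K (grad x F i) = ψ (grad Φ F i) := fun F i => hxval _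
  constructor
  · obtain ⟨s, F, h, hh, hF, hE⟩ := exists_conormal_frame (k := ℂ) Φ
    obtain ⟨-, hspan⟩ := hE K ψ (by rwa [map_ne_zero_iff _ hψ])
    -- W' is a K-combination of tails of gradients over L. These lie in the span of a frame for the
    -- cone over X, and clearing denominators gives a relation over Q.
    have hmem : (fun i => algebraMap Q K (W i.succ)) ∈ Submodule.span K
        (Set.range fun (j : Fin s) (i : Fin m) => algebraMap Q K (grad Φ (F j) i.succ)) := by
      have h1 : (Submodule.span K (Set.range fun j => grad (fun i => ψ (Φ i)) (F j))).map
          (LinearMap.funLeft K K (Fin.succ : Fin m → Fin (m + 1))) = Submodule.span K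
        (Set.range fun (j : Fin s) (i : Fin m) => algebraMap Q K (grad Φ (F j) i.succ)) := by
        rw [Submodule.map_span, ← Set.range_comp]
        congr 2
        ext j i
        change grad (fun i => ψ (Φ i)) (F j) i.succ = _
        rw [grad_map]
        rfl
      rw [← h1, ← hspan]
      change w ∈ _
      rw [haq]
      refine Submodule.sum_mem _ fun j _ => Submodule.smul_mem _ _ ?_
      have h2 : q j ∈ tailConormal ℂ x := hq ▸ Submodule.subset_span ⟨j, rfl⟩
      obtain ⟨v, hv, hvq⟩ := h2
      rw [← hvq]
      refine ⟨fun i => algebraMap L K (v i), ?_, rfl⟩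
      change v ∈ conormal _ _ at hv
      rw [conormal] at hv
      change (fun i => algebraMap L K (v i)) ∈ conormal _ _
      clear hvq
      induction hv using Submodule.span_induction with
      | mem v hv =>
        obtain ⟨G, hG, rfl⟩ := hv
        refine Submodule.subset_span ⟨G, (hxker G).mp hG, ?_⟩
        rw [grad_map]
        exact (_root_.funext fun i => hgrad G i).symm
      | zero => exact (by ext; simp : (fun i => algebraMap L K ((0 : Fin (m + 1) → L) i)) = 0) ▸
          Submodule.zero_mem _
      | add a b _ _ ha hb =>
        simp only [Pi.add_apply, map_add]
        exact Submodule.add_mem _ ha hb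
      | smul c a _ ha =>
        simp only [Pi.smul_apply, smul_eq_mul, map_mul]
        exact Submodule.smul_mem _ _ ha
    obtain ⟨r, hr, b, hb⟩ := exists_smul_mem_span_of_mem_span _ _ hmem
    refine ⟨s, F, r, b, hr, hF, fun i => ?_⟩
    simpa using congrFun hb i
  · intro g hg e F hF
    have hτ : ∀ τ : K, aeval (Fin.cons τ fun i => τ * p i.succ : Fin (m + 1) → K) g = 0 := by
      intro τ
      let ρ : Polynomial A →ₐ[ℂ] K := (Polynomial.aeval τ : Polynomial A →ₐ[A] K).restrictScalars ℂ
      have h1 := congrArg ρ hg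
      rw [comp_aeval_apply, map_zero] at h1
      rw [← h1]
      congr 2
      ext i
      refine Fin.cases ?_ (fun i => ?_) i
      · simp [ρ]
      · simp only [Fin.cons_succ, map_mul]
        simp only [ρ, AlgHom.restrictScalars_apply, Polynomial.aeval_X, Polynomial.aeval_C]
        rfl
    have h1 := aeval_normal_eq_zero x p M hdet u w rfl hw q a ha haq g hτ (algebraMap ℂ L e)
      (fun i => grad x F i.succ) (by
        rw [hq]
        exact ⟨grad x F, Submodule.subset_span ⟨F, (hxker F).mpr hF, rfl⟩, rfl⟩)
    apply hψ
    rw [map_zero, comp_aeval_apply]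
    have h2 := congrArg (algebraMap L K) h1
    rw [map_zero, ← IsScalarTower.coe_toAlgHom' ℂ L K, comp_aeval_apply] at h2
    rw [← h2]
    congr 2
    ext i
    refine Fin.cases ?_ (fun i => ?_) i
    · simp only [Fin.cons_zero, map_mul, AlgHom.commutes]
      rfl
    · simp only [Fin.cons_succ, map_mul, map_add, AlgHom.commutes, map_mulVec_apply, hψG]
      rw [show ψ (algebraMap ℂ (MvPolynomial (Fin d) A) e) = algebraMap ℂ K e from ψ.commutes e,
        show (fun i : Fin m => IsScalarTower.toAlgHom ℂ L K (grad x F i.succ)) =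
          fun i => ψ (grad Φ F i.succ) from _root_.funext fun i => hgrad F i.succ]
      rfl

end GenericPoint


/-! ### The ideal of the inverse focal construction -/

section Ideal

/-- Over the fraction field the gradient of f' is the generic combination at suitable coefficients
c, so the relation F specializes by X ↦ c. This reaches all conormal vectors at good points, even
where the frame itself degenerates. -/
theorem aeval_spherePoint_eq_zero {m d : ℕ} {A : Type} [CommRing A] [Algebra ℂ A] [IsDomain A]
    (G : Matrix (Fin m) (Fin m) ℂ) (y : Fin (m + 1) → A)
    (f : Fin d → MvPolynomial (Fin (m + 1)) ℂ) {F f' : MvPolynomial (Fin (m + 1)) ℂ}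
    (hF : aeval (genericPoint G y f) F = 0)
    (hf' : (fun i => algebraMap A (FractionRing A) (grad y f' i)) ∈
      Submodule.span (FractionRing A)
        (Set.range fun j i => algebraMap A (FractionRing A) (grad y (f j) i))) :
    aeval (spherePoint G y (grad y f')) F = 0 := by
  obtain ⟨c, hc⟩ := (Submodule.mem_span_range_iff_exists_fun _).mp hf'
  let K := FractionRing A
  let ρ : MvPolynomial (Fin d) A →ₐ[ℂ] K :=
    (aeval c : MvPolynomial (Fin d) A →ₐ[A] K).restrictScalars ℂ
  have hρC : ∀ a, ρ (C a) = algebraMap A K a := fun a => by simp [ρ, K]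
  have hρX : ∀ j, ρ (X j) = c j := fun j => by simp [ρ]
  have h1 := congrArg ρ hF
  rw [comp_aeval_apply, map_zero] at h1
  apply IsFractionRing.injective A K
  rw [map_zero, ← IsScalarTower.coe_toAlgHom' ℂ A K, comp_aeval_apply, ← h1]
  congr 2
  ext i
  rw [genericPoint, map_spherePoint, map_spherePoint]
  congr 1
  · ext i; rw [hρC]; rfl
  · ext i
    have h2 := congrFun hc i
    simp only [Finset.sum_apply, Pi.smul_apply, smul_eq_mul] at h2
    simp only [genericGrad, map_sum, map_mul, hρC, hρX]
    exact h2.symm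

theorem genericGrad_zero_ne_zero {m d : ℕ} {A : Type} [CommRing A] [Algebra ℂ A]
    (y : Fin (m + 1) → A) (f : Fin d → MvPolynomial (Fin (m + 1)) ℂ) {j : Fin d}
    (hj : grad y (f j) 0 ≠ 0) : genericGrad y f 0 ≠ 0 := by
  classical
  intro h
  have h1 := congrArg (aeval (Pi.single j 1 : Fin d → A)) h
  simp only [genericGrad, map_sum, map_mul, aeval_X, algHom_C, map_zero, Pi.single_apply] at h1
  simp at h1
  exact hj h1

theorem spherePoint_smul {m : ℕ} (G : Matrix (Fin m) (Fin m) ℂ) (p w : Fin (m + 1) → ℂ) (c : ℂ) :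
    spherePoint G p (c • w) = c • spherePoint G p w := by
  ext i
  refine Fin.cases ?_ (fun i => ?_) i
  · simp; ring
  · have : (fun i : Fin m => (c • w) i.succ) = c • fun i : Fin m => w i.succ := rfl
    rw [spherePoint_succ, this, Matrix.mulVec_smul]
    simp only [spherePoint_succ, Pi.smul_apply, smul_eq_mul]
    ring

variable {m d : ℕ} {S : Set (P m)} {R : Set (Fin (m + 1) → ℂ)}
  {B : LinearMap.BilinForm ℂ (Fin m → ℂ)} {M : Matrix (Fin m) (Fin m) ℂ}
  {f : Fin d → MvPolynomial (Fin (m + 1)) ℂ}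

/-- The combination of `f` with coefficients `c`. -/
noncomputable def combination (f : Fin d → MvPolynomial (Fin (m + 1)) ℂ) (c : Fin d → ℂ) :
    MvPolynomial (Fin (m + 1)) ℂ :=
  ∑ j, C (c j) * f j

theorem combination_mem {I : Ideal (MvPolynomial (Fin (m + 1)) ℂ)} (hf : ∀ j, f j ∈ I)
    (c : Fin d → ℂ) : combination f c ∈ I :=
  Ideal.sum_mem _ fun j _ => I.mul_mem_left _ (hf j)

theorem grad_combination {E : Type} [CommRing E] [Algebra ℂ E] (p : Fin (m + 1) → E)
    (c : Fin d → ℂ) : grad p (combination f c) = ∑ j, c j • grad p (f j) := by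
  ext i
  simp [combination, grad, Algebra.smul_def]

theorem evalAt₂_genericGrad {p : Fin (m + 1) → ℂ} (hp : p ∈ R) (c : Fin d → ℂ)
    (i : Fin (m + 1)) :
    evalAt₂ hp c (genericGrad (coordFun R) f i) = grad p (combination f c) i := by
  have h1 : ∀ j, evalAt hp (grad (coordFun R) (f j) i) = grad p (f j) i := fun j => by
    have := congrFun (grad_map (coordFun R) (evalAt hp) (f j)) i
    simp only [evalAt_coordFun] at this
    exact this.symm
  simp [genericGrad, grad_combination, h1]

theorem evalAt₂_genericPoint {p : Fin (m + 1) → ℂ} (hp : p ∈ R) (c : Fin d → ℂ)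
    (i : Fin (m + 1)) :
    evalAt₂ hp c (genericPoint M⁻¹ (coordFun R) f i) =
      spherePoint M⁻¹ p (grad p (combination f c)) i := by
  refine (map_spherePoint (evalAt₂ hp c) M⁻¹ (fun i => C (coordFun R i))
    (genericGrad (coordFun R) f) i).trans ?_
  simp only [evalAt₂_genericGrad, evalAt₂_C, evalAt_coordFun]

theorem evalAt₂_aeval_genericPoint {p : Fin (m + 1) → ℂ} (hp : p ∈ R) (c : Fin d → ℂ)
    (F : MvPolynomial (Fin (m + 1)) ℂ) :
    evalAt₂ hp c (aeval (genericPoint M⁻¹ (coordFun R) f) F) =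
      aeval (spherePoint M⁻¹ p (grad p (combination f c))) F := by
  rw [comp_aeval_apply]
  simp only [evalAt₂_genericPoint]

/-- A nonzero function on the parameter space is nonzero at some good point. -/
theorem exists_good_evalAt₂_ne_zero (hR : IsAlgebraicFunction S R)
    (hW : genericGrad (coordFun R) f 0 ≠ 0) {g : MvPolynomial (Fin d) (CoordRing R)} (hg : g ≠ 0) :
    ∃ (p : Fin (m + 1) → ℂ) (hp : p ∈ R) (c : Fin d → ℂ), p ∈ graphGood S R ∧
      grad p (combination f c) 0 ≠ 0 ∧ evalAt₂ hp c g ≠ 0 := by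
  have := hR.1.2
  obtain ⟨H, hH, hgood⟩ := exists_graphGood hR
  have hH' : (C (Ideal.Quotient.mk _ H) : MvPolynomial (Fin d) (CoordRing R)) ≠ 0 := by
    rw [C_ne_zero, Ne, Ideal.Quotient.eq_zero_iff_mem]
    exact hH
  obtain ⟨p, hp, c, h⟩ := exists_evalAt₂_ne_zero (mul_ne_zero (mul_ne_zero hH' hW) hg)
  rw [map_mul, map_mul, evalAt₂_C, evalAt_mk, evalAt₂_genericGrad] at h
  exact ⟨p, hp, c, hgood p hp (left_ne_zero_of_mul (left_ne_zero_of_mul h)),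
    right_ne_zero_of_mul (left_ne_zero_of_mul h), right_ne_zero_of_mul h⟩

theorem spherePoint_mem_cone (hdet : IsUnit M.det) (hB : ∀ u v, B u v = M.mulVec u ⬝ᵥ v)
    (hsph : ∀ p ∈ graphGood S R, ∀ x, (x, p) ∈ affineSpaces B R → (x, p) ∈ spheres B)
    {p : Fin (m + 1) → ℂ} (hp : p ∈ graphGood S R) {h : MvPolynomial (Fin (m + 1)) ℂ}
    (hh : h ∈ vanishingIdeal ℂ R) (h0 : grad p h 0 ≠ 0) :
    spherePoint M⁻¹ p (grad p h) ∈
      cone (ofAffine '' (Prod.fst '' inverseIncidence B S R)) := by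
  have h1 := mem_affineSpaces_of_grad hdet hB hh h0
  rw [spherePoint_eq_smul h0]
  exact mem_cone_ofAffine_image.mpr ⟨_, ⟨_, ⟨hp, hsph p hp _ h1, h1⟩, rfl⟩, _,
    mul_ne_zero two_ne_zero h0, rfl⟩

/-- A polynomial nonzero at the generic point is nonzero at a good specialization, which lies on the
cone because the sphere condition is automatic. Conversely each point of the cone over X' comes from
the gradient of an equation, to which the generic relation specializes. -/
theorem vanishingIdeal_cone_inverseFocal (hR : IsAlgebraicFunction S R) (hdet : IsUnit M.det)
    (hB : ∀ u v, B u v = M.mulVec u ⬝ᵥ v)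
    (hsph : ∀ p ∈ graphGood S R, ∀ x, (x, p) ∈ affineSpaces B R → (x, p) ∈ spheres B)
    (hf : ∀ j, f j ∈ vanishingIdeal ℂ R)
    (hspan : ∀ h ∈ vanishingIdeal ℂ R,
      (fun i => algebraMap (CoordRing R) (FractionRing (CoordRing R)) (grad (coordFun R) h i)) ∈
        Submodule.span (FractionRing (CoordRing R)) (Set.range fun j i =>
          algebraMap (CoordRing R) (FractionRing (CoordRing R)) (grad (coordFun R) (f j) i)))
    (hW : genericGrad (coordFun R) f 0 ≠ 0) :
    vanishingIdeal ℂ (cone (inverseFocal B S R)) =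
      RingHom.ker (aeval (genericPoint M⁻¹ (coordFun R) f) :
        MvPolynomial (Fin (m + 1)) ℂ →ₐ[ℂ] MvPolynomial (Fin d) (CoordRing R)) := by
  have hprime := hR.1.2
  rw [inverseFocal, vanishingIdeal_cone_projClosure]
  ext F
  rw [RingHom.mem_ker]
  constructor
  · intro hF
    by_contra hne
    obtain ⟨p, hp, c, hgood, h0, h⟩ := exists_good_evalAt₂_ne_zero hR hW hne
    rw [evalAt₂_aeval_genericPoint] at h
    exact h (hF _ (spherePoint_mem_cone hdet hB hsph hgood (combination_mem hf c) h0))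
  · intro hF v hv
    obtain ⟨_, ⟨⟨x, p⟩, ⟨hgood, -, haff⟩, rfl⟩, c, hc, rfl⟩ := mem_cone_ofAffine_image.mp hv
    obtain ⟨h, hh, hx⟩ := exists_spherePoint_of_mem_affineSpaces hdet hB haff
    rw [← hx, ← spherePoint_smul, ← grad_C_mul]
    have hh' := Ideal.mul_mem_left _ (C c) hh
    have h1 := congrArg (evalAt hgood.1.1)
      (aeval_spherePoint_eq_zero M⁻¹ (coordFun R) f hF (hspan _ hh'))
    rw [map_zero, comp_aeval_apply] at h1
    rw [← h1]
    congr 2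
    ext i
    rw [map_spherePoint, ← grad_map]
    simp only [evalAt_coordFun]

/-- The identity may be checked at good parameters, where it is the sphere equation of the point O +
M⁻¹w'/(2w_0), multiplied by 4w_0². -/
theorem sphere_relation (hR : IsAlgebraicFunction S R) (hdet : IsUnit M.det)
    (hB : ∀ u v, B u v = M.mulVec u ⬝ᵥ v)
    (hsph : ∀ p ∈ graphGood S R, ∀ x, (x, p) ∈ affineSpaces B R → (x, p) ∈ spheres B)
    (hf : ∀ j, f j ∈ vanishingIdeal ℂ R) (hW : genericGrad (coordFun R) f 0 ≠ 0) :
    (fun i : Fin m => genericGrad (coordFun R) f i.succ) ⬝ᵥ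
      (M⁻¹.map (algebraMap ℂ (MvPolynomial (Fin d) (CoordRing R)))).mulVec
        (fun i => genericGrad (coordFun R) f i.succ) =
        4 * genericGrad (coordFun R) f 0 ^ 2 * C (coordFun R 0) := by
  rw [← sub_eq_zero]
  by_contra hne
  obtain ⟨p, hp, c, hgood, h0, h⟩ := exists_good_evalAt₂_ne_zero hR hW hne
  apply h
  have h1 := mem_affineSpaces_of_grad hdet hB (combination_mem hf c) h0
  have h2 := hsph p hgood _ h1
  change B (_ - Fin.tail p) (_ - Fin.tail p) = p 0 at h2
  set w := grad p (combination f c) with hw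
  rw [hB, add_sub_cancel_left, Matrix.mulVec_smul, Matrix.mulVec_mulVec,
    Matrix.mul_nonsing_inv _ hdet, Matrix.one_mulVec, smul_dotProduct, dotProduct_smul,
    smul_eq_mul, smul_eq_mul] at h2
  rw [map_sub, dotProduct, map_sum, map_mul, map_mul, map_pow, map_ofNat, evalAt₂_genericGrad,
    evalAt₂_C, evalAt_coordFun, ← h2]
  have h4 : ∀ i : Fin m, evalAt₂ hp c
      ((M⁻¹.map (algebraMap ℂ (MvPolynomial (Fin d) (CoordRing R)))).mulVec
        (fun i => genericGrad (coordFun R) f i.succ) i) =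
      (M⁻¹.map (algebraMap ℂ ℂ)).mulVec (fun i => w i.succ) i := fun i => by
    refine (map_mulVec_apply (evalAt₂ hp c) M⁻¹
      (fun i => genericGrad (coordFun R) f i.succ) i).trans ?_
    simp only [evalAt₂_genericGrad, hw]
  simp only [map_mul, h4, evalAt₂_genericGrad]
  rw [← hw]
  have h3 : (∑ i : Fin m, w i.succ *
      (M⁻¹.map (algebraMap ℂ ℂ)).mulVec (fun i => w i.succ) i) =
      (fun i : Fin m => w i.succ) ⬝ᵥ M⁻¹.mulVec fun i => w i.succ := by
    simp [dotProduct]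
  rw [h3]
  field_simp
  ring

end Ideal


/-! ### Normal spaces and ramification -/

section Normal

variable {m : ℕ} {S X : Set (P m)} {B : LinearMap.BilinForm ℂ (Fin m → ℂ)}
  {M : Matrix (Fin m) (Fin m) ℂ}

theorem inclV'_eq_cons (u : Fin m → ℂ) : inclV' m u = Fin.cons 0 u := rfl

theorem dotProduct_cons_zero (q : Fin (m + 1) → ℂ) (u : Fin m → ℂ) :
    q ⬝ᵥ (Fin.cons 0 u : Fin (m + 1) → ℂ) = (fun i : Fin m => q i.succ) ⬝ᵥ u := by
  simp [dotProduct, Fin.sum_univ_succ]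

theorem mem_orthogonal_of_grad (hdet : IsUnit M.det) (hBsymm : B.IsSymm)
    (hB : ∀ u v, B u v = M.mulVec u ⬝ᵥ v) {v : V m} {F : MvPolynomial (Fin (m + 1)) ℂ}
    (hF : F ∈ vanishingIdeal ℂ (cone X)) :
    M⁻¹.mulVec (fun i => grad v F i.succ) ∈
      B.orthogonal ((tangentSpace (cone X) v).comap (inclV' m)) := by
  intro t ht
  change B t _ = 0
  rw [← hBsymm.eq, hB, Matrix.mulVec_mulVec, Matrix.mul_nonsing_inv _ hdet,
    Matrix.one_mulVec, ← dotProduct_cons_zero]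
  exact mem_tangentSpace.mp ht F hF

/-- M turns a vector orthogonal to the tangent directions in V' into a covector killing them, and by
double annihilation that is the tail of a gradient. -/
theorem exists_grad_of_mem_orthogonal (hdet : IsUnit M.det) (hBsymm : B.IsSymm)
    (hB : ∀ u v, B u v = M.mulVec u ⬝ᵥ v) {v : V m} {w : Fin m → ℂ}
    (hw : w ∈ B.orthogonal ((tangentSpace (cone X) v).comap (inclV' m))) :
    ∃ F ∈ vanishingIdeal ℂ (cone X), w = M⁻¹.mulVec (fun i => grad v F i.succ) := by
  have h1 : M.mulVec w ∈ (conormal (vanishingIdeal ℂ (cone X)) v).map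
      (LinearMap.funLeft ℂ ℂ (Fin.succ : Fin m → Fin (m + 1))) := by
    refine mem_of_dotProduct_annihilated fun t ht => ?_
    rw [← hB, ← hBsymm.eq]
    refine hw t ?_
    change inclV' m t ∈ tangentSpace (cone X) v
    rw [mem_tangentSpace]
    intro f hf
    rw [inclV'_eq_cons, dotProduct_cons_zero]
    exact mem_annihilated.mp ht _ ⟨grad v f, Submodule.subset_span ⟨f, hf, rfl⟩, rfl⟩
  obtain ⟨q, hq, hqw⟩ := h1
  obtain ⟨F, hF, rfl⟩ := (mem_conormal_iff_exists_grad _ _ _).mp hq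
  refine ⟨F, hF, ?_⟩
  change (fun i : Fin m => grad v F i.succ) = M.mulVec w at hqw
  rw [hqw, Matrix.mulVec_mulVec, Matrix.nonsing_inv_mul _ hdet, Matrix.one_mulVec]

/-- A vector of the normal space has the form e v + (0, M⁻¹(∇F)'), which is exactly what `hkey`
treats. -/
theorem snd_mem_of_mem_normalGood (hS : projClosure S = S) (hdet : IsUnit M.det)
    (hBsymm : B.IsSymm) (hB : ∀ u v, B u v = M.mulVec u ⬝ᵥ v)
    (hkey : ∀ g ∈ vanishingIdeal ℂ (cone S), ∀ e : ℂ, ∀ F ∈ vanishingIdeal ℂ (cone X),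
      ∀ v ∈ cone X, aeval (Fin.cons (e * v 0) fun i => e * v i.succ +
        M⁻¹.mulVec (fun i => grad v F i.succ) i : Fin (m + 1) → ℂ) g = 0)
    {z : P m × P m} (hz : z ∈ normalGood B X) : z.2 ∈ S := by
  obtain ⟨hzX, -, -, hz2⟩ := hz
  rw [← hS, mem_projClosure_iff]
  intro g hg
  have h1 : z.2.rep ∈ normalSpace B X z.1 := hz2 (by
    rw [Projectivization.submodule_eq]
    exact Submodule.mem_span_singleton_self _)
  obtain ⟨a, ha, b, hb, hab⟩ := Submodule.mem_sup.mp h1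
  rw [Projectivization.submodule_eq] at ha
  obtain ⟨e, rfl⟩ := Submodule.mem_span_singleton.mp ha
  obtain ⟨w, hw, rfl⟩ := hb
  obtain ⟨F, hF, rfl⟩ := exists_grad_of_mem_orthogonal hdet hBsymm hB hw
  rw [← hkey g hg e F hF _ (rep_mem_cone_iff.mpr hzX), ← hab]
  congr 2
  ext i
  refine Fin.cases ?_ (fun i => ?_) i <;> simp [inclV'_eq_cons]

/-- Solving the parametrization for the base point gives (1, O) = (v - (0, M⁻¹w'))/(2w_0), and w' is
the tail of a gradient, so O lies in the join of v with the normal directions. -/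
theorem mem_normalGood_of_spherePoint (hdet : IsUnit M.det) (hBsymm : B.IsSymm)
    (hB : ∀ u v, B u v = M.mulVec u ⬝ᵥ v) {p w : Fin (m + 1) → ℂ} (hw0 : w 0 ≠ 0)
    (hv : spherePoint M⁻¹ p w ≠ 0) (hvX : spherePoint M⁻¹ p w ∈ cone X)
    (hsm : IsSmoothPoint (cone X) (spherePoint M⁻¹ p w)) {F : MvPolynomial (Fin (m + 1)) ℂ}
    (hF : F ∈ vanishingIdeal ℂ (cone X))
    (hwF : ∀ i : Fin m, w i.succ = grad (spherePoint M⁻¹ p w) F i.succ) :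
    (Projectivization.mk ℂ (spherePoint M⁻¹ p w) hv, ofAffine (Fin.tail p)) ∈ normalGood B X := by
  set v := spherePoint M⁻¹ p w with hvdef
  obtain ⟨c, hc, hrep⟩ := exists_rep_mk_eq hv
  refine ⟨(mem_cone_mk hv).mp hvX, ?_, ?_, ?_⟩
  · change IsSmoothPoint (cone X) _
    rw [hrep, isSmoothPoint_cone_smul hc]
    exact hsm
  · change Projectivization.mk ℂ v hv ∉ _
    rw [notMem_atInfinity_mk]
    exact mul_ne_zero two_ne_zero hw0
  · change (ofAffine (Fin.tail p)).submodule ≤ normalSpace B X (Projectivization.mk ℂ v hv)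
    rw [ofAffine, Projectivization.submodule_mk, Submodule.span_singleton_le_iff_mem, normalSpace,
      orthogonalAt, projTangentSpace, hrep, tangentSpace_cone_smul X v hc,
      Projectivization.submodule_mk]
    have h1 : (Fin.cons 1 (Fin.tail p) : V m) = (2 * w 0)⁻¹ • v +
        inclV' m ((-(2 * w 0)⁻¹) • M⁻¹.mulVec (fun i => grad v F i.succ)) := by
      have h2 : (fun i : Fin m => grad v F i.succ) = fun i => w i.succ :=
        _root_.funext fun i => (hwF i).symm
      rw [h2, inclV'_eq_cons, hvdef]
      ext i
      refine Fin.cases ?_ (fun i => ?_) i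
      · simp; field_simp
      · simp [Fin.tail]
        field_simp
        ring
    rw [h1]
    refine Submodule.add_mem_sup (Submodule.smul_mem _ _ (Submodule.mem_span_singleton_self _)) ?_
    exact ⟨_, Submodule.smul_mem _ _ (mem_orthogonal_of_grad hdet hBsymm hB hF), rfl⟩

/-- The pairs of points with second component in `S` do not map submersively at a point with second
component smooth on a proper subvariety `S`. -/
theorem not_sndSubmersiveAt {N : Set (P m × P m)} (hN : ∀ z ∈ N, z.2 ∈ S) {z : P m × P m}
    (hz : z ∈ N) {g : MvPolynomial (Fin (m + 1)) ℂ} (hg : g ∈ vanishingIdeal ℂ (cone S))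
    {v : V m} (hv : v ∈ cone {z.2}) {i : Fin (m + 1)} (hi : aeval v (pderiv i g) ≠ 0) :
    ¬ SndSubmersiveAt N z := by
  classical
  intro h
  -- The second components of vectors tangent to the bicone are tangent to the cone over S, and so
  -- is the point itself by Euler's relation. Submersivity would make every vector tangent, against
  -- the nonzero derivative of g.
  have hT : tangentSpace (cone S) z.2.rep = ⊤ := by
    rw [eq_top_iff, ← h]
    refine sup_le ?_ ?_
    · rintro _ ⟨t, ht, rfl⟩
      rw [mem_tangentSpace]
      intro f hf
      have hf' : rename Sum.inr f ∈ vanishingIdeal ℂ (bicone N) := by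
        rintro u ⟨h1, h2, hu⟩
        rw [aeval_rename]
        exact hf _ ⟨h2, hN _ hu⟩
      have h1 := ht _ hf'
      rw [Fintype.sum_sum_type] at h1
      have h2 : ∀ j : Fin (m + 1),
          pderiv (Sum.inl j : Fin (m + 1) ⊕ Fin (m + 1)) (rename Sum.inr f) = 0 := by
        intro j
        refine pderiv_eq_zero_of_notMem_vars fun hj => ?_
        obtain ⟨k, _, hk⟩ := Finset.mem_image.mp (vars_rename Sum.inr f hj)
        cases hk
      simp only [h2, map_zero, zero_mul, Finset.sum_const_zero, zero_add,
        pderiv_rename Sum.inr_injective, eval_rename] at h1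
      exact h1
    · rw [Projectivization.submodule_eq, Submodule.span_singleton_le_iff_mem]
      exact self_mem_tangentSpace_cone (rep_mem_cone_iff.mpr (hN z hz))
  obtain ⟨c, hc, rfl⟩ := mem_cone_singleton.mp hv
  rw [← tangentSpace_cone_smul S _ hc] at hT
  have h1 : (Pi.single i 1 : V m) ∈ tangentSpace (cone S) (c • z.2.rep) := hT ▸ Submodule.mem_top
  have h2 := mem_tangentSpace.mp h1 g hg
  rw [dotProduct_single, mul_one] at h2
  exact hi h2

theorem snd_mem_of_mem_biprojClosure {N : Set (P m × P m)} (hS : projClosure S = S)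
    (hN : ∀ z ∈ N, z.2 ∈ S) {z : P m × P m} (hz : z ∈ biprojClosure N) : z.2 ∈ S := by
  rw [← hS, mem_projClosure_iff]
  intro g hg
  have h1 := hz (rename Sum.inr g) (by
    rintro u ⟨h1, h2, hu⟩
    rw [aeval_rename]
    exact hg _ ⟨h2, hN _ hu⟩) (Sum.elim z.1.rep z.2.rep)
    ⟨z.1.rep_nonzero, z.2.rep_nonzero, by simp⟩
  rw [eval_rename] at h1
  exact h1

end Normal

/-! ### Equations of S pulled back to the graph -/

section Points

variable {m : ℕ} {S : Set (P m)} {R : Set (Fin (m + 1) → ℂ)}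

theorem affinePart_nonempty (hR : IsAlgebraicFunction S R) : (affinePart S).Nonempty := by
  by_contra h
  rw [Set.not_nonempty_iff_eq_empty] at h
  apply (isPrime_vanishingIdeal_affinePart hR).ne_top
  rw [h, vanishingIdeal_empty]

theorem eval_mapAlgHom_aeval_cone {A : Type} [CommRing A] [Algebra ℂ A] (ε : A →ₐ[ℂ] ℂ)
    (y : Fin (m + 1) → A) (e : ℂ) (g : MvPolynomial (Fin (m + 1)) ℂ) :
    Polynomial.eval e (Polynomial.mapAlgHom ε (aeval (Fin.cons Polynomial.X
      (fun i => Polynomial.X * Polynomial.C (y i.succ)) : Fin (m + 1) → Polynomial A) g)) =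
    aeval (Fin.cons e fun i => e * ε (y i.succ) : Fin (m + 1) → ℂ) g := by
  rw [comp_aeval_apply, ← Polynomial.coe_aeval_eq_eval, comp_aeval_apply]
  congr 2
  ext i
  refine Fin.cases ?_ (fun i => ?_) i
  · simp
  · simp
    ring

theorem aeval_cone_generic_eq_zero (hR : IsAlgebraicFunction S R)
    {g : MvPolynomial (Fin (m + 1)) ℂ} (hg : g ∈ vanishingIdeal ℂ (cone S)) :
    aeval (Fin.cons Polynomial.X (fun i => Polynomial.X * Polynomial.C (coordFun R i.succ)) :
        Fin (m + 1) → Polynomial (CoordRing R)) g = 0 := by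
  ext k
  rw [Polynomial.coeff_zero]
  obtain ⟨a, ha⟩ := Ideal.Quotient.mk_surjective (Polynomial.coeff
    (aeval (Fin.cons Polynomial.X (fun i => Polynomial.X * Polynomial.C (coordFun R i.succ)) :
        Fin (m + 1) → Polynomial (CoordRing R)) g) k)
  rw [← ha, Ideal.Quotient.eq_zero_iff_mem]
  intro p hp
  have h1 : Polynomial.mapAlgHom (evalAt hp) (aeval (Fin.cons Polynomial.X
      (fun i => Polynomial.X * Polynomial.C (coordFun R i.succ)) :
        Fin (m + 1) → Polynomial (CoordRing R)) g) = 0 := by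
    refine Polynomial.eq_zero_of_infinite_isRoot _ ?_
    refine Set.Infinite.mono (s := {e : ℂ | e ≠ 0}) (fun e he => ?_)
      (Set.finite_singleton (0 : ℂ)).infinite_compl
    rw [Set.mem_ofPred_eq, Polynomial.IsRoot]
    refine (eval_mapAlgHom_aeval_cone (evalAt hp) (coordFun R) e g).trans ?_
    rw [← hg _ (cons_one_smul_mem_cone (hR.2.1 p hp) he)]
    congr 2
    ext i
    refine Fin.cases ?_ (fun i => ?_) i <;> simp [Fin.tail]
  have h2 := congrArg (fun q => Polynomial.coeff q k) h1
  simp only [Polynomial.coe_mapAlgHom, Polynomial.coeff_map, Polynomial.coeff_zero] at h2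
  rw [← ha] at h2
  exact h2

/-- Since h need not be homogeneous, it is restricted to the slice of the cone with first coordinate
c, for some c where it does not vanish identically. The function a is this restriction pulled back
to the graph. -/
theorem exists_coord_ne_zero_of_notMem (hS : IsProjectiveVariety S) (hR : IsAlgebraicFunction S R)
    {h : MvPolynomial (Fin (m + 1)) ℂ} (hh : h ∉ vanishingIdeal ℂ (cone S)) :
    ∃ c : ℂ, c ≠ 0 ∧ ∃ a : CoordRing R, a ≠ 0 ∧ ∀ (p : Fin (m + 1) → ℂ) (hp : p ∈ R),
      evalAt hp a = aeval (Fin.cons c fun i => c * p i.succ : Fin (m + 1) → ℂ) h := by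
  have hX : (X 0 : MvPolynomial (Fin (m + 1)) ℂ) ∉ vanishingIdeal ℂ (cone S) := by
    intro hX
    obtain ⟨O, hO⟩ := affinePart_nonempty hR
    have := hX _ ((ofAffine_mem_iff (X := S)).mp hO)
    simp at this
  -- Primality, with X_0 not vanishing on the cone, provides a point of the affine part at which h
  -- is nonzero; its first coordinate is the scale c.
  have hXh := hS.2.mul_notMem hX hh
  obtain ⟨v, hv, hvh⟩ : ∃ v ∈ cone S, aeval v (X 0 * h) ≠ 0 := by
    by_contra! hcon
    exact hXh hcon
  rw [map_mul, aeval_X] at hvh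
  have hv0 := left_ne_zero_of_mul hvh
  have hvO : (fun i : Fin m => v i.succ / v 0) ∈ affinePart S := by
    refine (ofAffine_mem_iff (X := S)).mpr ?_
    rw [← smul_mem_cone_iff hv0]
    convert hv using 1
    ext i
    refine Fin.cases ?_ (fun i => ?_) i
    · simp
    · simp; field_simp
  let φ : MvPolynomial (Fin m) ℂ := aeval (Fin.cons (C (v 0)) fun i => C (v 0) * X i :
    Fin (m + 1) → MvPolynomial (Fin m) ℂ) h
  have hφ : ∀ {E : Type} [CommRing E] [Algebra ℂ E] (O : Fin m → E), aeval O φ =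
      aeval (Fin.cons (algebraMap ℂ E (v 0)) fun i => algebraMap ℂ E (v 0) * O i :
        Fin (m + 1) → E) h := by
    intro E _ _ O
    rw [comp_aeval_apply]
    congr 2
    ext i
    refine Fin.cases ?_ (fun i => ?_) i <;> simp
  have hφ' : φ ∉ vanishingIdeal ℂ (affinePart S) := by
    intro hφI
    have h1 := hφI _ hvO
    rw [hφ] at h1
    apply right_ne_zero_of_mul hvh
    rw [← h1]
    congr 2
    ext i
    refine Fin.cases ?_ (fun i => ?_) i
    · simp
    · simp; field_simp
  refine ⟨v 0, hv0, aeval (fun i : Fin m => coordFun R i.succ) φ,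
    fun h0 => hφ' ((mem_vanishingIdeal_affinePart_iff hR φ).mpr h0), fun p hp => ?_⟩
  rw [comp_aeval_apply, hφ]
  simp

end Points


/-! ### The inverse focal construction yields degenerate varieties with the given focal locus -/

section Main

variable {m : ℕ} {S : Set (P m)} {R : Set (Fin (m + 1) → ℂ)}

/-- Equations of the graph of an algebraic function whose gradients form a basis of the generic
conormal space. -/
theorem exists_graph_frame (hR : IsAlgebraicFunction S R) :
    ∃ (d n : ℕ) (f : Fin d → MvPolynomial (Fin (m + 1)) ℂ),
      (∀ j, aeval (coordFun R) (f j) = 0) ∧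
      LinearIndependent (FractionRing (CoordRing R)) (fun j i =>
        algebraMap (CoordRing R) (FractionRing (CoordRing R)) (grad (coordFun R) (f j) i)) ∧
      (∀ h ∈ vanishingIdeal ℂ R,
        (fun i => algebraMap (CoordRing R) (FractionRing (CoordRing R)) (grad (coordFun R) h i)) ∈
          Submodule.span (FractionRing (CoordRing R)) (Set.range fun j i =>
            algebraMap (CoordRing R) (FractionRing (CoordRing R)) (grad (coordFun R) (f j) i))) ∧
      Algebra.trdeg ℂ (CoordRing R) = n ∧ n + d = m + 1 ∧ genericGrad (coordFun R) f 0 ≠ 0 := by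
  have := hR.1.2
  obtain ⟨d, f, h, hh, hf, hE⟩ := exists_conormal_frame (k := ℂ) (coordFun R)
  obtain ⟨h1, h2⟩ := hE (FractionRing (CoordRing R)) (IsScalarTower.toAlgHom ℂ _ _)
    (by simpa using hh)
  obtain ⟨n, hn, hnd⟩ := natCast_add_trdeg_eq_card (k := ℂ) (coordFun R) (adjoin_coordFun R) f h1 h2
  rw [Fintype.card_fin] at hnd
  have hg : ∀ g : MvPolynomial (Fin (m + 1)) ℂ,
      grad (fun i => IsScalarTower.toAlgHom ℂ (CoordRing R) (FractionRing (CoordRing R))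
        (coordFun R i)) g =
      fun i => algebraMap (CoordRing R) (FractionRing (CoordRing R)) (grad (coordFun R) g i) :=
    fun g => grad_map (coordFun R) (IsScalarTower.toAlgHom ℂ (CoordRing R) _) g
  simp only [hg] at h1 h2
  rw [ker_aeval_coordFun] at h2
  have hspan : ∀ h ∈ vanishingIdeal ℂ R,
      (fun i => algebraMap (CoordRing R) (FractionRing (CoordRing R)) (grad (coordFun R) h i)) ∈
        Submodule.span (FractionRing (CoordRing R)) (Set.range fun j i =>
          algebraMap (CoordRing R) (FractionRing (CoordRing R)) (grad (coordFun R) (f j) i)) := by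
    intro h hh
    rw [← h2, ← hg]
    exact (Submodule.subset_span ⟨h, hh, rfl⟩)
  refine ⟨d, n, f, hf, h1, hspan, hn, hnd, ?_⟩
  by_contra hW
  have h0 : ∀ j, grad (coordFun R) (f j) 0 = 0 := fun j => by
    by_contra hj
    exact genericGrad_zero_ne_zero _ _ hj hW
  -- If W_0 were zero, all gradients of equations of the graph would have zero vertical component,
  -- contrary to the choice of g.
  obtain ⟨g, hg, hg0⟩ := exists_pderiv_zero_notMem hR
  obtain ⟨c, hc⟩ := (Submodule.mem_span_range_iff_exists_fun _).mp (hspan g hg)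
  have h3 := congrFun hc 0
  simp only [Finset.sum_apply, Pi.smul_apply, h0, map_zero, smul_zero, Finset.sum_const_zero] at h3
  rw [eq_comm, map_eq_zero_iff _ (IsFractionRing.injective _ _)] at h3
  rw [← ker_aeval_coordFun] at hg0
  exact hg0 h3

variable {d : ℕ} {f : Fin d → MvPolynomial (Fin (m + 1)) ℂ}

/-- An identity along the generic normal line bundle holds at all normal vectors. -/
theorem aeval_cone_normal_eq_zero {A : Type} [CommRing A] [Algebra ℂ A] {Y : Set (P m)}
    {Φ : Fin (m + 1) → A}
    (hJ : vanishingIdeal ℂ (cone Y) =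
      RingHom.ker (aeval Φ : MvPolynomial (Fin (m + 1)) ℂ →ₐ[ℂ] A))
    {G : Matrix (Fin m) (Fin m) ℂ} {g F : MvPolynomial (Fin (m + 1)) ℂ} {e : ℂ}
    (h : aeval (Fin.cons (algebraMap ℂ A e * Φ 0) fun i => algebraMap ℂ A e * Φ i.succ +
      (G.map (algebraMap ℂ A)).mulVec (fun i => grad Φ F i.succ) i : Fin (m + 1) → A) g = 0)
    {v : V m} (hv : v ∈ cone Y) :
    aeval (Fin.cons (e * v 0) fun i => e * v i.succ +
      G.mulVec (fun i => grad v F i.succ) i : Fin (m + 1) → ℂ) g = 0 := by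
  -- The identity depends polynomially on the point, since the gradient of F does. So it is a single
  -- polynomial, which belongs to the ideal of Y as soon as it vanishes at Φ.
  let Q : MvPolynomial (Fin (m + 1)) ℂ :=
    aeval (Fin.cons (C e * X 0) fun i => C e * X i.succ +
      (G.map C).mulVec (fun i => pderiv i.succ F) i :
        Fin (m + 1) → MvPolynomial (Fin (m + 1)) ℂ) g
  have hQ : ∀ {E : Type} [CommRing E] [Algebra ℂ E] (x : Fin (m + 1) → E), aeval x Q =
      aeval (Fin.cons (algebraMap ℂ E e * x 0) fun i => algebraMap ℂ E e * x i.succ +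
        (G.map (algebraMap ℂ E)).mulVec (fun i => grad x F i.succ) i : Fin (m + 1) → E) g := by
    intro E _ _ x
    rw [comp_aeval_apply]
    congr 2
    ext i
    refine Fin.cases ?_ (fun i => ?_) i
    · simp
    · simp [Matrix.mulVec, dotProduct, grad]
  have hmem : Q ∈ vanishingIdeal ℂ (cone Y) := by
    rw [hJ, RingHom.mem_ker]
    exact (hQ Φ).trans h
  have h1 := hmem v hv
  rw [hQ] at h1
  exact h1

theorem aeval_cone_normal_eq_zero_of_generic {A : Type} [CommRing A] [Algebra ℂ A] {Y : Set (P m)}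
    {y : Fin (m + 1) → A} {G : Matrix (Fin m) (Fin m) ℂ}
    (hJ : ∀ F, F ∈ vanishingIdeal ℂ (cone Y) ↔ aeval (genericPoint G y f) F = 0)
    (h : ∀ g : MvPolynomial (Fin (m + 1)) ℂ, aeval (Fin.cons Polynomial.X fun i =>
        Polynomial.X * Polynomial.C (y i.succ) : Fin (m + 1) → Polynomial A) g = 0 →
      ∀ e : ℂ, ∀ F : MvPolynomial (Fin (m + 1)) ℂ, aeval (genericPoint G y f) F = 0 →
        aeval (Fin.cons (algebraMap ℂ (MvPolynomial (Fin d) A) e * genericPoint G y f 0) fun i =>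
          algebraMap ℂ (MvPolynomial (Fin d) A) e * genericPoint G y f i.succ +
            (G.map (algebraMap ℂ (MvPolynomial (Fin d) A))).mulVec
              (fun i => grad (genericPoint G y f) F i.succ) i :
          Fin (m + 1) → MvPolynomial (Fin d) A) g = 0)
    {g : MvPolynomial (Fin (m + 1)) ℂ} (hg : aeval (Fin.cons Polynomial.X fun i =>
        Polynomial.X * Polynomial.C (y i.succ) : Fin (m + 1) → Polynomial A) g = 0)
    (e : ℂ) {F : MvPolynomial (Fin (m + 1)) ℂ} (hF : F ∈ vanishingIdeal ℂ (cone Y))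
    {v : V m} (hv : v ∈ cone Y) :
    aeval (Fin.cons (e * v 0) fun i => e * v i.succ +
      G.mulVec (fun i => grad v F i.succ) i : Fin (m + 1) → ℂ) g = 0 :=
  aeval_cone_normal_eq_zero (Φ := genericPoint G y f) (Ideal.ext hJ) (h g hg e F ((hJ F).mp hF)) hv

end Main

theorem inverseFocal_degenerate_and_focalLocus_eq (m : ℕ) (B : LinearMap.BilinForm ℂ (Fin m → ℂ)) (hBsymm : B.IsSymm)
    (hBnondeg : B.Nondegenerate)
    (S : Set (P m)) (hS : IsProjectiveVariety S) (hSne : S ≠ Set.univ)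
    (R : Set (Fin (m + 1) → ℂ)) (hR : IsAlgebraicFunction S R)
    (h1 : ∀ O : Fin m → ℂ, IsSmoothPoint (affinePart S) O →
      HasTotallyIsotropicAnnihilator B (tangentSpace (affinePart S) O))
    (h21 : ∀ p ∈ graphGood S R, ∃ ξ : Fin m → ℂ, MapsToDifferential B S R p ξ)
    (h22 : ∀ p ∈ graphGood S R, ∀ ξ : Fin m → ℂ, MapsToDifferential B S R p ξ →
      (1 / 4) * B ξ ξ = p 0) :
    (IsProjectiveVariety (inverseFocal B S R) ∧ ¬ inverseFocal B S R ⊆ atInfinity m) ∧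
      IsIsotropicallyFocallyDegenerate B (inverseFocal B S R) ∧
      focalLocus B (inverseFocal B S R) = S := by
  obtain ⟨M, hM, hdet, hB⟩ := exists_gramMatrix hBsymm hBnondeg
  have hsph : ∀ p ∈ graphGood S R, ∀ x, (x, p) ∈ affineSpaces B R → (x, p) ∈ spheres B :=
    fun p hp x hx => mem_spheres_of_mem_affineSpaces hBsymm hBnondeg hR h1 h21 h22 hp hx
  have hRprime := hR.1.2
  obtain ⟨d, n, f, hf, hli, hspan, hn, hnd, hW⟩ := exists_graph_frame hR
  have hfR : ∀ j, f j ∈ vanishingIdeal ℂ R := fun j => by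
    rw [← ker_aeval_coordFun]; exact hf j
  have hJ := vanishingIdeal_cone_inverseFocal hR hdet hB hsph hfR hspan hW
  obtain ⟨⟨s, F, r, b, hr, hF, hb⟩, hnormal⟩ := exists_generic_normal (coordFun R)
    (adjoin_coordFun R) M hM hdet f hf hli hn hnd hW (sphere_relation hR hdet hB hsph hfR hW)
  have hXprime : (vanishingIdeal ℂ (cone (inverseFocal B S R))).IsPrime := by
    rw [hJ]
    exact RingHom.ker_isPrime _
  have hkey : ∀ g ∈ vanishingIdeal ℂ (cone S), ∀ e : ℂ,
      ∀ F ∈ vanishingIdeal ℂ (cone (inverseFocal B S R)), ∀ v ∈ cone (inverseFocal B S R),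
      aeval (Fin.cons (e * v 0) fun i => e * v i.succ +
        M⁻¹.mulVec (fun i => grad v F i.succ) i : Fin (m + 1) → ℂ) g = 0 := by
    intro g hg e F hF v hv
    have hJ' : ∀ F, F ∈ vanishingIdeal ℂ (cone (inverseFocal B S R)) ↔
        aeval (genericPoint M⁻¹ (coordFun R) f) F = 0 := fun F => by rw [hJ, RingHom.mem_ker]
    exact aeval_cone_normal_eq_zero_of_generic hJ' hnormal (aeval_cone_generic_eq_zero hR hg) e hF hv
  have hsnd : ∀ z ∈ normalGood B (inverseFocal B S R), z.2 ∈ S :=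
    fun z hz => snd_mem_of_mem_normalGood hS.1 hdet hBsymm hB hkey hz
  have hmem : ∀ {p c}, p ∈ graphGood S R → grad p (combination f c) 0 ≠ 0 →
      spherePoint M⁻¹ p (grad p (combination f c)) ∈ cone (inverseFocal B S R) := by
    intro p c hp h0
    obtain ⟨hv, hvX⟩ := spherePoint_mem_cone hdet hB hsph hp (combination_mem hfR c) h0
    exact ⟨hv, subset_projClosure _ hvX⟩
  refine ⟨⟨⟨projClosure_projClosure _, hXprime⟩, fun hinf => ?_⟩, fun huniv => hSne ?_, ?_⟩
  · obtain ⟨p, hp, c, hgood, h0, -⟩ := exists_good_evalAt₂_ne_zero hR hW one_ne_zero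
    obtain ⟨hv, hvX⟩ := hmem hgood h0
    exact (notMem_atInfinity_mk hv).mpr (mul_ne_zero two_ne_zero h0) (hinf hvX)
  · rw [Set.eq_univ_iff_forall] at huniv ⊢
    intro x
    rw [← hS.1]
    refine projClosure_mono ?_ (huniv x)
    rintro _ ⟨z, hz, rfl⟩
    exact snd_mem_of_mem_biprojClosure hS.1 hsnd hz
  · apply subset_antisymm
    · refine (projClosure_mono ?_).trans_eq hS.1
      rintro _ ⟨z, hz, rfl⟩
      exact hsnd z hz.1
    · intro x hx
      rw [focalLocus, mem_projClosure_iff]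
      intro h hh
      suffices hhS : h ∈ vanishingIdeal ℂ (cone S) from hhS _ (rep_mem_cone_iff.mpr hx)
      by_contra hhS
      -- An equation of S with a derivative not identically zero on S: it forces ramification over
      -- general points of S.
      obtain ⟨g, hg, i, hi⟩ := exists_grad_notMem hS hSne
      obtain ⟨ch, hch, ah, hah, hah'⟩ := exists_coord_ne_zero_of_notMem hS hR hhS
      obtain ⟨cg, hcg, ag, hag, hag'⟩ := exists_coord_ne_zero_of_notMem hS hR hi
      obtain ⟨H, hH, hHsm⟩ := exists_smooth_of_isPrime (cone (inverseFocal B S R))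
      have hH' : aeval (genericPoint M⁻¹ (coordFun R) f) H ≠ 0 := fun h0 => hH (by
        rw [hJ]; exact h0)
      -- The parameters avoid four bad loci at once: h = 0 at O, ∂_i g = 0 at O, the denominator r =
      -- 0, and the exceptional locus outside which x is smooth on X.
      obtain ⟨p, hp, c, hgood, h0, hne⟩ := exists_good_evalAt₂_ne_zero hR hW
        (mul_ne_zero (mul_ne_zero (mul_ne_zero ((C_ne_zero (σ := Fin d)).mpr hah)
          ((C_ne_zero (σ := Fin d)).mpr hag)) hr) hH')
      rw [map_mul, map_mul, map_mul, evalAt₂_C, evalAt₂_C, hah', hag',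
        evalAt₂_aeval_genericPoint] at hne
      have hne1 := left_ne_zero_of_mul hne
      have hne2 := left_ne_zero_of_mul hne1
      have hrne := right_ne_zero_of_mul hne1
      have hcone := hmem hgood h0
      have hsm := hHsm _ hcone (right_ne_zero_of_mul hne)
      have hpS := hR.2.1 p hp
      -- The generic expression of W' through gradients of equations of X, specialized at (p, c):
      -- one equation whose gradient at x has tail w', so that O is normal to X at x.
      let F' : MvPolynomial (Fin (m + 1)) ℂ :=
        combination F fun j => (evalAt₂ hp c r)⁻¹ * evalAt₂ hp c (b j)
      have hF' : F' ∈ vanishingIdeal ℂ (cone (inverseFocal B S R)) :=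
        combination_mem (fun j => by rw [hJ]; exact hF j) _
      have hw : ∀ i : Fin m, grad p (combination f c) i.succ =
          grad (spherePoint M⁻¹ p (grad p (combination f c))) F' i.succ := by
        intro i
        have h3 := congrArg (evalAt₂ hp c) (hb i)
        have h4 : ∀ j, evalAt₂ hp c (grad (genericPoint M⁻¹ (coordFun R) f) (F j) i.succ) =
            grad (spherePoint M⁻¹ p (grad p (combination f c))) (F j) i.succ :=
          fun j => evalAt₂_aeval_genericPoint hp c _
        rw [map_mul, map_sum, evalAt₂_genericGrad] at h3
        simp only [map_mul, h4] at h3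
        rw [grad_combination (c := fun j => (evalAt₂ hp c r)⁻¹ * evalAt₂ hp c (b j)),
          Finset.sum_apply]
        simp only [Pi.smul_apply, smul_eq_mul, mul_assoc, ← Finset.mul_sum]
        rw [← h3, inv_mul_cancel_left₀ hrne]
      have hz := mem_normalGood_of_spherePoint hdet hBsymm hB h0 hcone.1 hcone hsm hF' hw
      have hv : ∀ {e : ℂ}, e ≠ 0 →
          (Fin.cons e fun i : Fin m => e * p i.succ : V m) ∈ cone {ofAffine (Fin.tail p)} :=
        fun he => cons_one_smul_mem_cone (X := {ofAffine (Fin.tail p)}) (u := Fin.tail p) rfl he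
      have hram := not_sndSubmersiveAt hsnd hz hg (hv hcg) (right_ne_zero_of_mul hne2)
      apply left_ne_zero_of_mul hne2
      -- O is now in the image of the ramification locus, so h vanishes on the line over O, contrary
      -- to the choice of parameters.
      refine hh _ ⟨(hv hch).1, _, ⟨hz, hram⟩, ?_⟩
      exact (hv hch).2.symm

end FocalLoci

theorem theorem5 (m : ℕ) (B : LinearMap.BilinForm ℂ (Fin m → ℂ)) (hBsymm : B.IsSymm)
    (hBnondeg : B.Nondegenerate)
    (S : Set (P m)) (hS : IsProjectiveVariety S) (hSne : S ≠ Set.univ)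
    (R : Set (Fin (m + 1) → ℂ)) (hR : IsAlgebraicFunction S R)
    (h1 : ∀ O : Fin m → ℂ, IsSmoothPoint (affinePart S) O →
      HasTotallyIsotropicAnnihilator B (tangentSpace (affinePart S) O))
    (h21 : ∀ p ∈ graphGood S R, ∃ ξ : Fin m → ℂ, MapsToDifferential B S R p ξ)
    (h22 : ∀ p ∈ graphGood S R, ∀ ξ : Fin m → ℂ, MapsToDifferential B S R p ξ →
      (1 / 4) * B ξ ξ = p 0) :
    (IsProjectiveVariety (inverseFocal B S R) ∧ ¬ inverseFocal B S R ⊆ atInfinity m) ∧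
      IsIsotropicallyFocallyDegenerate B (inverseFocal B S R) ∧
      focalLocus B (inverseFocal B S R) = S := by
  exact inverseFocal_degenerate_and_focalLocus_eq m B hBsymm hBnondeg S hS hSne R hR h1 h21 h22
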